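/- Let $(M,g)$ be a smooth 2-dimensional Riemannian manifold with Levi-Civita connection $\nabla$, curvature tensor $R(X,Y)Z=\nabla_X\nabla_YZ-\nabla_Y\nabla_XZ-\nabla_{[X,Y]}Z$ and Gaussian curvature $K$. Let $U\subset M$ be open (for instance $U=M$) and let $\xi,\eta,e_0,e_1$ be smooth vector fields on $U$ such that $(\xi,\eta)$ and $(e_0,e_1)$ are orthonormal frames and $\nabla_{e_0}\xi=0$. Put $$\lambda=\langle\nabla_{e_1}\xi,\eta\rangle,\qquad \mu=\langle\nabla_{e_0}e_0,e_1\rangle,\qquad \sigma=\langle\nabla_{e_1}e_1,e_0\rangle ,$$ and, at each point, let $s=1$ if the frames $(\xi,\eta)$ and $(e_0,e_1)$ have the same orientation there and $s=0$ otherwise. Let $TM$ carry the Sasaki metric $\langle\!\langle X_1^h+X_2^v,\,Y_1^h+Y_2^v\rangle\!\rangle=\langle X_1,Y_1\rangle+\langle X_2,Y_2\rangle$, where $h$ and $v$ denote horizontal and vertical lifts, and let the unit tangent bundle $T_1M\subset TM$ carry the induced metric. Consider $\xi$ as a map $U\to T_1M$ and set, along $\xi$, $$\tilde e_0=e_0^h,\qquad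 \tilde e_1=\frac{e_1^h+\lambda\,\eta^v}{\sqrt{1+\lambda^2}},\qquad \tilde n=\frac{-\lambda\, e_1^h+\eta^v}{\sqrt{1+\lambda^2}} .$$ Then at every point of $U$ one has $\tilde e_0=d\xi(e_0)$ and $\tilde e_1=d\xi\big(e_1/\sqrt{1+\lambda^2}\big)$, the vectors $(\tilde e_0,\tilde e_1)$ form an orthonormal frame of the tangent plane of $\xi(U)$, and $\tilde n$ is a unit normal of $\xi(U)$ in $T_1M$. The matrix $\Omega$, in the frame $(\tilde e_0,\tilde e_1)$, of the second fundamental form of $\xi(U)\subset T_1M$ with respect to $\tilde n$ is given by each of the following two forms: (i) $$\Omega=\begin{bmatrix} -\mu\,\dfrac{\lambda}{\sqrt{1+\lambda^2}} & (-1)^{s+1}\dfrac K2+\dfrac{e_0(\lambda)}{1+\lambda^2}\\[2ex] (-1)^{s+1}\dfrac K2+\dfrac{e_0(\lambda)}{1+\lambda^2} & e_1\!\left(\dfrac{\lambda}{\sqrt{1+\lambda^2}}\right)\end{bmatrix},$$ (ii) $$\Omega=\begin{bmatrix} -\mu\,\dfrac{\lambda}{\sqrt{1+\lambda^2}} & \dfrac12\left(\sigma\lambda+\dfrac{1-\lambda^2}{1+\lambda^2}\,e_0(\lambda)\right)\\[2ex]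 \dfrac12\left(\sigma\lambda+\dfrac{1-\lambda^2}{1+\lambda^2}\,e_0(\lambda)\right) & e_1\!\left(\dfrac{\lambda}{\sqrt{1+\lambda^2}}\right)\end{bmatrix}.$$ -/

import Mathlib

open scoped Manifold ContDiff

noncomputable section

namespace UnitField

/-! ### Riemannian geometry in local coordinates -/

section Coordinates

variable {ι κ : Type} [Fintype ι] [DecidableEq ι] [Fintype κ] [DecidableEq κ]

/-- The scalar product `∑ aᵢⱼ vⁱ wʲ` of two vectors with respect to a Gram matrix `a`. -/
def dot (a : Matrix ι ι ℝ) (v w : EuclideanSpace ℝ ι) : ℝ :=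
  ∑ i, ∑ j, a i j * v i * w j

/-- The `i`-th coordinate vector. -/
def basisVec (i : ι) : EuclideanSpace ℝ ι := EuclideanSpace.single i 1

/-- The partial derivative `∂ᵢ f` at `x`. -/
def partialDeriv (i : ι) (f : EuclideanSpace ℝ ι → ℝ) (x : EuclideanSpace ℝ ι) : ℝ :=
  fderiv ℝ f x (basisVec i)

/-- The Christoffel symbol `Γᵏᵢⱼ` at `x` of the Levi-Civita connection of the metric `g`. -/
def christoffel (g : EuclideanSpace ℝ ι → Matrix ι ι ℝ) (x : EuclideanSpace ℝ ι)
    (k i j : ι) : ℝ :=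
  (1 / 2) * ∑ l, (g x)⁻¹ k l *
    (partialDeriv i (fun y => g y j l) x + partialDeriv j (fun y => g y i l) x
      - partialDeriv l (fun y => g y i j) x)

/-- The vector with components `Γᵏᵢⱼ(x) uⁱ vʲ`. -/
def gam (g : EuclideanSpace ℝ ι → Matrix ι ι ℝ) (x u v : EuclideanSpace ℝ ι) :
    EuclideanSpace ℝ ι :=
  WithLp.toLp 2 fun k => ∑ i, ∑ j, christoffel g x k i j * u i * v j

/-- The Levi-Civita covariant derivative at `x`, in the direction `u`, of a vector field `Y`
along the map `f` into a coordinate domain with metric `g` (`Y y` is a vector at `f y`). -/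
def covAlong (g : EuclideanSpace ℝ ι → Matrix ι ι ℝ)
    (f Y : EuclideanSpace ℝ κ → EuclideanSpace ℝ ι) (x u : EuclideanSpace ℝ κ) :
    EuclideanSpace ℝ ι :=
  fderiv ℝ Y x u + gam g (f x) (fderiv ℝ f x u) (Y x)

/-- The Levi-Civita covariant derivative `∇_X Y` of vector fields. -/
def cov (g : EuclideanSpace ℝ ι → Matrix ι ι ℝ) (X Y : EuclideanSpace ℝ ι → EuclideanSpace ℝ ι)
    (x : EuclideanSpace ℝ ι) : EuclideanSpace ℝ ι :=
  covAlong g id Y x (X x)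

/-- The curvature `R(X,Y)Z = ∇_X ∇_Y Z - ∇_Y ∇_X Z - ∇_[X,Y] Z`. -/
def curvature (g : EuclideanSpace ℝ ι → Matrix ι ι ℝ)
    (X Y Z : EuclideanSpace ℝ ι → EuclideanSpace ℝ ι) (x : EuclideanSpace ℝ ι) :
    EuclideanSpace ℝ ι :=
  cov g X (cov g Y Z) x - cov g Y (cov g X Z) x - cov g (VectorField.lieBracket ℝ X Y) Z x

/-- The Gaussian curvature `⟨R(∂₀,∂₁)∂₁,∂₀⟩ / det g` of a metric on a planar domain. -/
def gaussCurvature (g : EuclideanSpace ℝ (Fin 2) → Matrix (Fin 2) (Fin 2) ℝ)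
    (x : EuclideanSpace ℝ (Fin 2)) : ℝ :=
  dot (g x)
    (curvature g (fun _ => basisVec 0) (fun _ => basisVec 1) (fun _ => basisVec 1) x)
    (basisVec 0) / (g x).det

/-! ### The tangent bundle with the Sasaki metric, in the induced coordinates `(x, v)`

A point of the tangent bundle, or a vector tangent to the tangent bundle, has two blocks of
components: `Sum.inl` (base) and `Sum.inr` (fibre). -/

/-- The point, or the tangent vector, with base block `x` and fibre block `v`. -/
def pair (x v : EuclideanSpace ℝ ι) : EuclideanSpace ℝ (ι ⊕ ι) :=
  WithLp.toLp 2 (Sum.elim (fun i => x i) (fun i => v i))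

/-- The base block; on tangent vectors, the differential of the bundle projection. -/
def base (z : EuclideanSpace ℝ (ι ⊕ ι)) : EuclideanSpace ℝ ι :=
  WithLp.toLp 2 fun i => z (Sum.inl i)

/-- The fibre block. -/
def fibre (z : EuclideanSpace ℝ (ι ⊕ ι)) : EuclideanSpace ℝ ι :=
  WithLp.toLp 2 fun i => z (Sum.inr i)

/-- The horizontal lift `uʰ` of `u` to the point `z = (x, v)`. -/
def horLift (g : EuclideanSpace ℝ ι → Matrix ι ι ℝ) (z : EuclideanSpace ℝ (ι ⊕ ι))
    (u : EuclideanSpace ℝ ι) : EuclideanSpace ℝ (ι ⊕ ι) :=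
  pair u (-gam g (base z) u (fibre z))

/-- The vertical lift `uᵛ` of `u`. -/
def vertLift (u : EuclideanSpace ℝ ι) : EuclideanSpace ℝ (ι ⊕ ι) := pair 0 u

/-- The connection map: the vector `w` for which `A = (base A)ʰ + wᵛ` at the point `z`. -/
def connector (g : EuclideanSpace ℝ ι → Matrix ι ι ℝ) (z A : EuclideanSpace ℝ (ι ⊕ ι)) :
    EuclideanSpace ℝ ι :=
  fibre A + gam g (base z) (base A) (fibre z)

theorem horLift_add_vertLift (g : EuclideanSpace ℝ ι → Matrix ι ι ℝ)
    (z A : EuclideanSpace ℝ (ι ⊕ ι)) :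
    horLift g z (base A) + vertLift (connector g z A) = A := by
  ext i
  rcases i with i | i <;> simp [horLift, vertLift, connector, pair, base, fibre]

/-- The Gram matrix of the Sasaki metric
`⟪X₁ʰ + X₂ᵛ, Y₁ʰ + Y₂ᵛ⟫ = ⟨X₁, Y₁⟩ + ⟨X₂, Y₂⟩` on the tangent bundle. -/
def sasaki (g : EuclideanSpace ℝ ι → Matrix ι ι ℝ) (z : EuclideanSpace ℝ (ι ⊕ ι)) :
    Matrix (ι ⊕ ι) (ι ⊕ ι) ℝ :=
  Matrix.of fun a b =>
    dot (g (base z)) (base (basisVec a)) (base (basisVec b)) +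
      dot (g (base z)) (connector g z (basisVec a)) (connector g z (basisVec b))

/-- The orthogonal projection of `T_z(TM)` onto the tangent space at `z = (x, v)`, `|v| = 1`, of
the unit tangent bundle, whose unit normal in the tangent bundle is `vᵛ`. -/
def unitProj (g : EuclideanSpace ℝ ι → Matrix ι ι ℝ) (z W : EuclideanSpace ℝ (ι ⊕ ι)) :
    EuclideanSpace ℝ (ι ⊕ ι) :=
  W - dot (sasaki g z) W (vertLift (fibre z)) • vertLift (fibre z)

/-- The Levi-Civita covariant derivative of the unit tangent bundle with the metric induced by the
Sasaki metric (the tangential part of that of the tangent bundle), for a vector field `Y` along a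
map `f` into the unit tangent bundle. -/
def unitCovAlong (g : EuclideanSpace ℝ ι → Matrix ι ι ℝ)
    (f Y : EuclideanSpace ℝ κ → EuclideanSpace ℝ (ι ⊕ ι)) (x u : EuclideanSpace ℝ κ) :
    EuclideanSpace ℝ (ι ⊕ ι) :=
  unitProj g (f x) (covAlong (sasaki g) f Y x u)

/-- The second fundamental form, with respect to the normal vector `n` at `f x`, of a submanifold
of the unit tangent bundle with parametrization `f`, on the tangent vectors `df(u)`, `df(w)`:
the scalar product with `n` of the covariant derivative along `df(u)` of the field `df(w)`. -/
def secondForm (g : EuclideanSpace ℝ ι → Matrix ι ι ℝ)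
    (f : EuclideanSpace ℝ κ → EuclideanSpace ℝ (ι ⊕ ι)) (x : EuclideanSpace ℝ κ)
    (n : EuclideanSpace ℝ (ι ⊕ ι)) (u w : EuclideanSpace ℝ κ) : ℝ :=
  dot (sasaki g (f x)) (unitCovAlong g f (fun y => fderiv ℝ f y w) x u) n

/-- A vector field `X`, considered as a map into the tangent bundle. -/
def toTM (X : EuclideanSpace ℝ ι → EuclideanSpace ℝ ι) (x : EuclideanSpace ℝ ι) :
    EuclideanSpace ℝ (ι ⊕ ι) :=
  pair x (X x)

end Coordinates

/-! ### Unit vector fields on surfaces, in local coordinates -/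

section Surface

variable (g : EuclideanSpace ℝ (Fin 2) → Matrix (Fin 2) (Fin 2) ℝ)
  (ξ η e₀ e₁ : EuclideanSpace ℝ (Fin 2) → EuclideanSpace ℝ (Fin 2))

/-- The signed singular value `λ = ⟨∇_{e₁} ξ, η⟩`. -/
def lam (x : EuclideanSpace ℝ (Fin 2)) : ℝ := dot (g x) (cov g e₁ ξ x) (η x)

/-- The signed geodesic curvature `μ = ⟨∇_{e₀} e₀, e₁⟩` of the `e₀`-curves. -/
def mu (x : EuclideanSpace ℝ (Fin 2)) : ℝ := dot (g x) (cov g e₀ e₀ x) (e₁ x)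

/-- The signed geodesic curvature `σ = ⟨∇_{e₁} e₁, e₀⟩` of the `e₁`-curves. -/
def sig (x : EuclideanSpace ℝ (Fin 2)) : ℝ := dot (g x) (cov g e₁ e₁ x) (e₀ x)

open Classical in
/-- `s = 1` if the orthonormal frames `(ξ, η)` and `(e₀, e₁)` have the same orientation at `x`
(positive transition determinant), and `s = 0` otherwise. -/
def orient (x : EuclideanSpace ℝ (Fin 2)) : ℕ :=
  if 0 < dot (g x) (ξ x) (e₀ x) * dot (g x) (η x) (e₁ x)
      - dot (g x) (ξ x) (e₁ x) * dot (g x) (η x) (e₀ x) then 1 else 0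

/-- The frame `ẽ₀ = e₀ʰ`, `ẽ₁ = (e₁ʰ + λ ηᵛ) / √(1 + λ²)` along `ξ`. -/
def tangentFrame (x : EuclideanSpace ℝ (Fin 2)) : Fin 2 → EuclideanSpace ℝ (Fin 2 ⊕ Fin 2) :=
  ![horLift g (toTM ξ x) (e₀ x),
    (1 / √(1 + lam g ξ η e₁ x ^ 2)) •
      (horLift g (toTM ξ x) (e₁ x) + lam g ξ η e₁ x • vertLift (η x))]

/-- The vector `ñ = (-λ e₁ʰ + ηᵛ) / √(1 + λ²)` along `ξ`. -/
def unitNormal (x : EuclideanSpace ℝ (Fin 2)) : EuclideanSpace ℝ (Fin 2 ⊕ Fin 2) :=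
  (1 / √(1 + lam g ξ η e₁ x ^ 2)) •
    (-(lam g ξ η e₁ x • horLift g (toTM ξ x) (e₁ x)) + vertLift (η x))

/-- The vectors `u₀ = e₀`, `u₁ = e₁ / √(1 + λ²)` of the surface, with `dξ(uₐ) = ẽₐ`. -/
def preFrame (x : EuclideanSpace ℝ (Fin 2)) : Fin 2 → EuclideanSpace ℝ (Fin 2) :=
  ![e₀ x, (1 / √(1 + lam g ξ η e₁ x ^ 2)) • e₁ x]

/-- The matrix, in the frame `(ẽ₀, ẽ₁)`, of the second fundamental form with respect to `ñ` of
the image of `ξ` in the unit tangent bundle. -/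
def secondFormMatrix (x : EuclideanSpace ℝ (Fin 2)) : Matrix (Fin 2) (Fin 2) ℝ :=
  Matrix.of fun a b =>
    secondForm g (toTM ξ) x (unitNormal g ξ η e₁ x)
      (preFrame g ξ η e₀ e₁ x a) (preFrame g ξ η e₀ e₁ x b)

end Surface

/-! ### Passage from a manifold to a chart -/

section Chart

variable {M : Type*} [TopologicalSpace M] [ChartedSpace (EuclideanSpace ℝ (Fin 2)) M]

/-- The components of a vector field in the chart `φ`, as functions of the coordinates. -/
def fieldIn (φ : OpenPartialHomeomorph M (EuclideanSpace ℝ (Fin 2)))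
    (X : (q : M) → TangentSpace (𝓡 2) q) (y : EuclideanSpace ℝ (Fin 2)) :
    EuclideanSpace ℝ (Fin 2) :=
  mfderiv (𝓡 2) (𝓡 2) φ (φ.symm y) (X (φ.symm y))

/-- The coordinate vector field `∂ᵢ` of the chart `φ`, at the point with coordinates `y`. -/
def coordVec (φ : OpenPartialHomeomorph M (EuclideanSpace ℝ (Fin 2)))
    (i : Fin 2) (y : EuclideanSpace ℝ (Fin 2)) : TangentSpace (𝓡 2) (φ.symm y) :=
  mfderiv (𝓡 2) (𝓡 2) φ.symm y (basisVec i : EuclideanSpace ℝ (Fin 2))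

/-- The metric coefficients `gᵢⱼ = ⟨∂ᵢ, ∂ⱼ⟩` in the chart `φ`. -/
def metricIn [IsManifold (𝓡 2) ∞ M]
    (g : Bundle.ContMDiffRiemannianMetric (𝓡 2) ∞ (EuclideanSpace ℝ (Fin 2))
      (fun q : M => TangentSpace (𝓡 2) q))
    (φ : OpenPartialHomeomorph M (EuclideanSpace ℝ (Fin 2)))
    (y : EuclideanSpace ℝ (Fin 2)) : Matrix (Fin 2) (Fin 2) ℝ :=
  Matrix.of fun i j => g.inner (φ.symm y) (coordVec φ i y) (coordVec φ j y)

end Chart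

end UnitField

end

noncomputable section

namespace UnitField

/-! ### Differentiation of bilinear pairings with moving arguments -/

section Generic

variable {E F H K : Type*} [NormedAddCommGroup E] [NormedSpace ℝ E] [NormedAddCommGroup F]
  [NormedSpace ℝ F] [NormedAddCommGroup H] [NormedSpace ℝ H] [NormedAddCommGroup K]
  [NormedSpace ℝ K]

/-! Everything reduces to the covariant Hessian `hess` of `ξ` and to one curvature component,
computed in a chart.

For a vector `A` tangent to the tangent bundle, the Sasaki metric is the sum of the base metric on
`base A` and on `connector A`. The connection map is not closed: its antisymmetrized covariant
derivative is the curvature (`covAlong_connector_sub`). Feeding this into Koszul's formula gives the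
Sasaki connection (`dot_gam_sasaki`). Evaluated on `dξ(u)`, `dξ(w)` and a normal vector, it gives
the second fundamental form as the symmetrized Hessian of `ξ` plus terms pairing `∇ξ` with the
curvature (`IsMetricOn.secondForm_eq`). The correction from the tangent bundle to the unit tangent
bundle vanishes, because the normal is orthogonal to `ξᵛ`.

Since `ξ` is unit and parallel along `e₀`, one has `∇_v ξ = ⟨v, e₁⟩ λ η` (`cov_ξ`). Differentiating
`∇_{e₀} ξ = 0` and `∇_{e₁} ξ = λ η` gives the `η`-components of the Hessian: `-μλ` on `(e₀, e₀)`,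
`σλ` on `(e₁, e₀)`, and `v(λ)` on `(v, e₁)`. By the Ricci identity, `ρ = ⟨R(e₀, e₁)ξ, η⟩ = e₀(λ) -
σλ` (`dot_riem_frame`).

With `N = 1/√(1+λ²)`, the off-diagonal entry is `N² (e₀(λ) + σλ - λ²ρ)/2 = e₀(λ)/(1+λ²) - ρ/2`
(`secondFormMatrix_eq`). Form (ii) substitutes the value of `ρ` above. Form (i) uses that a surface
has a single curvature component, so `ρ = (-1)^s K` (`dot_riem_frame_eq_gauss`). -/

theorem contDiffAt_sum_smul_const {α : Type*} {s : Finset α} {c : α → E → ℝ} {a : α → F} {x : E}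
    (h : ∀ i, ContDiffAt ℝ ∞ (c i) x) : ContDiffAt ℝ ∞ (fun y => ∑ i ∈ s, c i y • a i) x :=
  ContDiffAt.sum fun i _ => (h i).smul contDiffAt_const

/-- The Leibniz rule behind all later derivatives: both the metric and the Christoffel symbols are
treated as bilinear maps depending on the base point. -/
theorem fderiv_clm_apply₂ {B : F → H →L[ℝ] H →L[ℝ] K} {f : E → F} {P Q : E → H} {x : E}
    (hB : DifferentiableAt ℝ B (f x)) (hf : DifferentiableAt ℝ f x) (hP : DifferentiableAt ℝ P x)
    (hQ : DifferentiableAt ℝ Q x) (u : E) :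
    fderiv ℝ (fun y => B (f y) (P y) (Q y)) x u = fderiv ℝ B (f x) (fderiv ℝ f x u) (P x) (Q x)
      + B (f x) (fderiv ℝ P x u) (Q x) + B (f x) (P x) (fderiv ℝ Q x u) := by
  have h1 : HasFDerivAt (fun y => B (f y)) (fderiv ℝ B (f x) ∘SL fderiv ℝ f x) x :=
    HasFDerivAt.comp (g := B) x hB.hasFDerivAt hf.hasFDerivAt
  have h2 := h1.clm_apply hP.hasFDerivAt
  have h3 := h2.clm_apply hQ.hasFDerivAt
  rw [h3.fderiv]
  simp
  abel

theorem differentiableAt_clm_apply₂ {B : F → H →L[ℝ] H →L[ℝ] K} {f : E → F} {P Q : E → H} {x : E}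
    (hB : DifferentiableAt ℝ B (f x)) (hf : DifferentiableAt ℝ f x) (hP : DifferentiableAt ℝ P x)
    (hQ : DifferentiableAt ℝ Q x) : DifferentiableAt ℝ (fun y => B (f y) (P y) (Q y)) x := by
  have h1 : DifferentiableAt ℝ (fun y => B (f y)) x :=
    DifferentiableAt.comp (g := B) x hB hf
  exact (h1.clm_apply hP).clm_apply hQ

end Generic

/-! ### The metric, Koszul's formula and metric compatibility -/

section Coordinates

variable {ι κ : Type} [Fintype ι] [Fintype κ]

/-- The scalar product with respect to a Gram matrix, as a continuous bilinear form. -/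
def dotL (a : Matrix ι ι ℝ) : EuclideanSpace ℝ ι →L[ℝ] EuclideanSpace ℝ ι →L[ℝ] ℝ :=
  ∑ i, ∑ j, a i j • (EuclideanSpace.proj i : EuclideanSpace ℝ ι →L[ℝ] ℝ).smulRight
    (EuclideanSpace.proj j : EuclideanSpace ℝ ι →L[ℝ] ℝ)

theorem dotL_apply (a : Matrix ι ι ℝ) (v w : EuclideanSpace ℝ ι) : dotL a v w = dot a v w := by
  simp [dotL, dot, mul_assoc]

theorem dot_comm {a : Matrix ι ι ℝ} (ha : ∀ i j, a i j = a j i) (v w : EuclideanSpace ℝ ι) :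
    dot a v w = dot a w v := by
  simp only [dot]
  rw [Finset.sum_comm]
  exact Finset.sum_congr rfl fun i _ => Finset.sum_congr rfl fun j _ => by rw [ha]; ring

variable [DecidableEq ι]

/-- The Christoffel symbols as a continuous bilinear map. -/
def gamL (g : EuclideanSpace ℝ ι → Matrix ι ι ℝ) (x : EuclideanSpace ℝ ι) :
    EuclideanSpace ℝ ι →L[ℝ] EuclideanSpace ℝ ι →L[ℝ] EuclideanSpace ℝ ι :=
  ∑ k, ∑ i, ∑ j, christoffel g x k i j •
    (EuclideanSpace.proj i : EuclideanSpace ℝ ι →L[ℝ] ℝ).smulRight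
      ((EuclideanSpace.proj j : EuclideanSpace ℝ ι →L[ℝ] ℝ).smulRight (basisVec k))

theorem gamL_apply (g : EuclideanSpace ℝ ι → Matrix ι ι ℝ) (x u v : EuclideanSpace ℝ ι) :
    gamL g x u v = gam g x u v := by
  ext m
  simp [gamL, gam, basisVec, mul_assoc, Pi.single_apply,
    Finset.sum_ite_eq]

theorem sum_smul_basisVec (v : EuclideanSpace ℝ ι) : ∑ i, v i • basisVec i = v := by
  ext j
  simp [basisVec, Pi.single_apply]

/-- Turns a Gram matrix defined entrywise from a bilinear form back into that form; used for the
Sasaki metric and for the metric read in a chart. -/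
theorem dot_of_bilin (L : EuclideanSpace ℝ ι →L[ℝ] EuclideanSpace ℝ ι →L[ℝ] ℝ)
    (v w : EuclideanSpace ℝ ι) :
    dot (Matrix.of fun i j => L (basisVec i) (basisVec j)) v w = L v w := by
  conv_rhs => rw [← sum_smul_basisVec v, ← sum_smul_basisVec w]
  simp only [map_sum, map_smul, sum_apply, smul_apply,
    smul_eq_mul, dot, Matrix.of_apply, Finset.mul_sum]
  rw [Finset.sum_comm]
  exact Finset.sum_congr rfl fun i _ => Finset.sum_congr rfl fun j _ => by ring

/-- The matrix field `g` is a smooth nondegenerate symmetric bilinear form on the open set `V`. -/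
structure IsMetricOn (g : EuclideanSpace ℝ ι → Matrix ι ι ℝ) (V : Set (EuclideanSpace ℝ ι)) :
    Prop where
  isOpen : IsOpen V
  smooth : ∀ x ∈ V, ∀ i j, ContDiffAt ℝ ∞ (fun y => g y i j) x
  symm : ∀ x ∈ V, ∀ i j, g x i j = g x j i
  det_ne : ∀ x ∈ V, (g x).det ≠ 0

theorem contDiffAt_det {E : Type*} [NormedAddCommGroup E] [NormedSpace ℝ E]
    {A : E → Matrix ι ι ℝ} {x : E} (h : ∀ i j, ContDiffAt ℝ ∞ (fun y => A y i j) x) :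
    ContDiffAt ℝ ∞ (fun y => (A y).det) x := by
  simp only [Matrix.det_apply]
  refine ContDiffAt.sum fun σ _ => ContDiffAt.const_smul _ ?_
  exact contDiffAt_prod fun i _ => h _ _

theorem contDiffAt_inv {E : Type*} [NormedAddCommGroup E] [NormedSpace ℝ E]
    {A : E → Matrix ι ι ℝ} {x : E} (h : ∀ i j, ContDiffAt ℝ ∞ (fun y => A y i j) x)
    (hd : (A x).det ≠ 0) (k l : ι) : ContDiffAt ℝ ∞ (fun y => (A y)⁻¹ k l) x := by
  simp only [Matrix.inv_def, Matrix.smul_apply, Matrix.adjugate_apply, Ring.inverse_eq_inv',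
    smul_eq_mul]
  refine ((contDiffAt_det h).inv hd).mul (contDiffAt_det fun i j => ?_)
  -- By Cramer's rule the adjugate entry is a determinant in which row `l` has been replaced by a
  -- constant vector.
  by_cases hi : i = l
  · subst hi
    simpa using contDiffAt_const
  · simpa [Matrix.updateRow_ne hi] using h i j

variable {g : EuclideanSpace ℝ ι → Matrix ι ι ℝ} {V : Set (EuclideanSpace ℝ ι)}
  {x : EuclideanSpace ℝ ι}

theorem contDiffAt_partialDeriv {f : EuclideanSpace ℝ ι → ℝ} (h : ContDiffAt ℝ ∞ f x) (i : ι) :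
    ContDiffAt ℝ ∞ (partialDeriv i f) x :=
  (h.fderiv_right (m := ∞) (by simp)).clm_apply contDiffAt_const

namespace IsMetricOn

theorem christoffel_contDiffAt (hg : IsMetricOn g V) (hx : x ∈ V) (k i j : ι) :
    ContDiffAt ℝ ∞ (fun y => christoffel g y k i j) x := by
  unfold christoffel
  refine contDiffAt_const.mul (ContDiffAt.sum fun l _ => ?_)
  refine (contDiffAt_inv (hg.smooth x hx) (hg.det_ne x hx) k l).mul ?_
  exact ((contDiffAt_partialDeriv (hg.smooth x hx _ _) _).add
    (contDiffAt_partialDeriv (hg.smooth x hx _ _) _)).sub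
    (contDiffAt_partialDeriv (hg.smooth x hx _ _) _)

theorem gamL_contDiffAt (hg : IsMetricOn g V) (hx : x ∈ V) : ContDiffAt ℝ ∞ (gamL g) x := by
  unfold gamL
  exact ContDiffAt.sum fun k _ => ContDiffAt.sum fun i _ =>
    contDiffAt_sum_smul_const fun j => hg.christoffel_contDiffAt hx k i j

theorem dotL_contDiffAt (hg : IsMetricOn g V) (hx : x ∈ V) :
    ContDiffAt ℝ ∞ (fun y => dotL (g y)) x := by
  unfold dotL
  exact ContDiffAt.sum fun i _ => contDiffAt_sum_smul_const fun j => hg.smooth x hx i j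

theorem dotL_differentiableAt (hg : IsMetricOn g V) (hx : x ∈ V) :
    DifferentiableAt ℝ (fun y => dotL (g y)) x :=
  (hg.dotL_contDiffAt hx).differentiableAt (by simp)

theorem gamL_differentiableAt (hg : IsMetricOn g V) (hx : x ∈ V) :
    DifferentiableAt ℝ (gamL g) x :=
  (hg.gamL_contDiffAt hx).differentiableAt (by simp)

theorem eventually_mem (hg : IsMetricOn g V) (hx : x ∈ V) : ∀ᶠ y in nhds x, y ∈ V :=
  hg.isOpen.mem_nhds hx

theorem partialDeriv_symm (hg : IsMetricOn g V) (hx : x ∈ V) (k i j : ι) :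
    partialDeriv k (fun y => g y i j) x = partialDeriv k (fun y => g y j i) x := by
  unfold partialDeriv
  have : (fun y => g y i j) =ᶠ[nhds x] fun y => g y j i := by
    filter_upwards [hg.eventually_mem hx] with y hy using hg.symm y hy i j
  rw [this.fderiv_eq]

theorem gam_comm (hg : IsMetricOn g V) (hx : x ∈ V) (u v : EuclideanSpace ℝ ι) :
    gam g x u v = gam g x v u := by
  ext k
  simp only [gam]
  rw [Finset.sum_comm]
  refine Finset.sum_congr rfl fun i _ => Finset.sum_congr rfl fun j _ => ?_
  have : christoffel g x k j i = christoffel g x k i j := by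
    unfold christoffel
    congr 1
    refine Finset.sum_congr rfl fun l _ => ?_
    rw [hg.partialDeriv_symm hx l j i]
    ring
  rw [this]
  ring

theorem fderiv_dotL_apply (hg : IsMetricOn g V) (hx : x ∈ V) (u v w : EuclideanSpace ℝ ι) :
    fderiv ℝ (fun y => dotL (g y)) x u v w
      = ∑ i, ∑ j, ∑ l, partialDeriv l (fun y => g y i j) x * u l * v i * w j := by
  have h1 : ∀ i j, DifferentiableAt ℝ (fun y => g y i j) x := fun i j =>
    (hg.smooth x hx i j).differentiableAt (by simp)
  have h2 := fderiv_clm_apply₂ (f := fun y => y) (P := fun _ => v) (Q := fun _ => w)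
    (hg.dotL_differentiableAt hx) differentiableAt_fun_id (differentiableAt_const v)
    (differentiableAt_const w) u
  simp only [fderiv_fun_id, ContinuousLinearMap.id_apply, fderiv_fun_const, Pi.zero_apply,
    zero_apply, map_zero, add_zero, dotL_apply, dot] at h2
  have h3 : HasFDerivAt (fun y => ∑ i, ∑ j, g y i j * v i * w j)
      (∑ i, ∑ j, w j • v i • fderiv ℝ (fun y => g y i j) x) x :=
    HasFDerivAt.fun_sum fun i _ => HasFDerivAt.fun_sum fun j _ =>
      ((h1 i j).hasFDerivAt.mul_const _).mul_const _
  rw [← h2, h3.fderiv]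
  simp only [sum_apply, smul_apply, smul_eq_mul]
  refine Finset.sum_congr rfl fun i _ => Finset.sum_congr rfl fun j _ => ?_
  conv_lhs => rw [← sum_smul_basisVec u]
  simp only [map_sum, map_smul, smul_eq_mul, Finset.mul_sum]
  refine Finset.sum_congr rfl fun l _ => ?_
  simp only [partialDeriv]
  ring

/-- Koszul's formula for constant vectors. -/
theorem dot_gam (hg : IsMetricOn g V) (hx : x ∈ V) (u v n : EuclideanSpace ℝ ι) :
    dot (g x) (gam g x u v) n = (1 / 2) * (fderiv ℝ (fun y => dotL (g y)) x u v n
      + fderiv ℝ (fun y => dotL (g y)) x v u n - fderiv ℝ (fun y => dotL (g y)) x n u v) := by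
  have hu : IsUnit (g x).det := isUnit_iff_ne_zero.2 (hg.det_ne x hx)
  -- Lowering the upper index cancels the inverse matrix in the Christoffel symbol.
  have key : ∀ i j p, ∑ m, g x m p * christoffel g x m i j
      = (1 / 2) * (partialDeriv i (fun y => g y j p) x + partialDeriv j (fun y => g y i p) x
        - partialDeriv p (fun y => g y i j) x) := by
    intro i j p
    have h3 : ∀ l, ∑ m, g x p m * (g x)⁻¹ m l = if p = l then 1 else 0 := by
      intro l
      rw [← Matrix.mul_apply, Matrix.mul_nonsing_inv _ hu, Matrix.one_apply]
    simp only [christoffel, Finset.mul_sum]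
    rw [Finset.sum_comm]
    have : ∀ l, ∑ m, g x m p * (1 / 2 * ((g x)⁻¹ m l *
        (partialDeriv i (fun y => g y j l) x + partialDeriv j (fun y => g y i l) x
        - partialDeriv l (fun y => g y i j) x))) = (if p = l then 1 else 0) * (1 / 2 *
        (partialDeriv i (fun y => g y j l) x + partialDeriv j (fun y => g y i l) x
        - partialDeriv l (fun y => g y i j) x)) := by
      intro l
      rw [← h3 l, Finset.sum_mul]
      refine Finset.sum_congr rfl fun m _ => ?_
      rw [hg.symm x hx m p]
      ring
    simp only [this]
    simp
  have hl : dot (g x) (gam g x u v) n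
      = ∑ i, ∑ j, ∑ p, (∑ m, g x m p * christoffel g x m i j) * (u i * v j * n p) := by
    simp only [dot, gam, Finset.sum_mul, Finset.mul_sum]
    rw [Finset.sum_comm' (t' := Finset.univ) (s' := fun _ => Finset.univ) (by simp)]
    calc _ = ∑ p, ∑ i, ∑ m, ∑ j, g x m p * (christoffel g x m i j * u i * v j) * n p :=
          Finset.sum_congr rfl fun p _ => Finset.sum_comm
      _ = ∑ i, ∑ p, ∑ m, ∑ j, g x m p * (christoffel g x m i j * u i * v j) * n p :=
          Finset.sum_comm
      _ = ∑ i, ∑ p, ∑ j, ∑ m, g x m p * (christoffel g x m i j * u i * v j) * n p :=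
          Finset.sum_congr rfl fun i _ => Finset.sum_congr rfl fun p _ => Finset.sum_comm
      _ = ∑ i, ∑ j, ∑ p, ∑ m, g x m p * (christoffel g x m i j * u i * v j) * n p :=
          Finset.sum_congr rfl fun i _ => Finset.sum_comm
      _ = _ := Finset.sum_congr rfl fun i _ => Finset.sum_congr rfl fun j _ =>
          Finset.sum_congr rfl fun p _ => Finset.sum_congr rfl fun m _ => by ring
  rw [hl]
  simp only [key, hg.fderiv_dotL_apply hx]
  have e1 : ∑ i, ∑ j, ∑ l, partialDeriv l (fun y => g y i j) x * u l * v i * n j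
      = ∑ i, ∑ j, ∑ p, partialDeriv i (fun y => g y j p) x * u i * v j * n p := by
    calc _ = ∑ i, ∑ l, ∑ j, partialDeriv l (fun y => g y i j) x * u l * v i * n j :=
          Finset.sum_congr rfl fun i _ => Finset.sum_comm
      _ = _ := Finset.sum_comm
  have e2 : ∑ i, ∑ j, ∑ l, partialDeriv l (fun y => g y i j) x * v l * u i * n j
      = ∑ i, ∑ j, ∑ p, partialDeriv j (fun y => g y i p) x * v j * u i * n p :=
    Finset.sum_congr rfl fun i _ => Finset.sum_comm
  rw [e1, e2]
  simp only [← Finset.sum_add_distrib, ← Finset.sum_sub_distrib, Finset.mul_sum]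
  exact Finset.sum_congr rfl fun i _ => Finset.sum_congr rfl fun j _ =>
    Finset.sum_congr rfl fun p _ => by ring

theorem fderiv_dotL_symm (hg : IsMetricOn g V) (hx : x ∈ V) (u v w : EuclideanSpace ℝ ι) :
    fderiv ℝ (fun y => dotL (g y)) x u v w = fderiv ℝ (fun y => dotL (g y)) x u w v := by
  simp only [hg.fderiv_dotL_apply hx]
  rw [Finset.sum_comm]
  refine Finset.sum_congr rfl fun i _ => Finset.sum_congr rfl fun j _ =>
    Finset.sum_congr rfl fun l _ => ?_
  rw [hg.partialDeriv_symm hx l j i]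
  ring

/-- Metric compatibility on constant fields: in the sum of the two Koszul formulas the derivatives
in the directions `v` and `w` cancel. -/
theorem fderiv_dotL_eq (hg : IsMetricOn g V) (hx : x ∈ V) (u v w : EuclideanSpace ℝ ι) :
    fderiv ℝ (fun y => dotL (g y)) x u v w
      = dot (g x) (gam g x u v) w + dot (g x) v (gam g x u w) := by
  rw [dot_comm (hg.symm x hx) v, hg.dot_gam hx, hg.dot_gam hx, hg.fderiv_dotL_symm hx u w v,
    hg.fderiv_dotL_symm hx w u v, hg.fderiv_dotL_symm hx v u w]
  ring

/-- The Levi-Civita connection along a map is compatible with the metric. -/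
theorem fderiv_dot (hg : IsMetricOn g V) {f P Q : EuclideanSpace ℝ κ → EuclideanSpace ℝ ι}
    {z : EuclideanSpace ℝ κ} (hz : f z ∈ V) (hf : DifferentiableAt ℝ f z)
    (hP : DifferentiableAt ℝ P z) (hQ : DifferentiableAt ℝ Q z) (u : EuclideanSpace ℝ κ) :
    fderiv ℝ (fun y => dot (g (f y)) (P y) (Q y)) z u
      = dot (g (f z)) (covAlong g f P z u) (Q z) + dot (g (f z)) (P z) (covAlong g f Q z u) := by
  simp only [← dotL_apply]
  rw [fderiv_clm_apply₂ (B := fun y => dotL (g y)) (hg.dotL_differentiableAt hz) hf hP hQ,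
    hg.fderiv_dotL_eq hz]
  simp only [covAlong, ← dotL_apply, map_add, add_apply]
  ring

end IsMetricOn

end Coordinates

/-! ### Smoothness of pairings and symmetry of second derivatives -/

section Generic

variable {E F H K : Type*} [NormedAddCommGroup E] [NormedSpace ℝ E] [NormedAddCommGroup F]
  [NormedSpace ℝ F] [NormedAddCommGroup H] [NormedSpace ℝ H] [NormedAddCommGroup K]
  [NormedSpace ℝ K]

theorem contDiffAt_clm_apply₂ {B : F → H →L[ℝ] H →L[ℝ] K} {f : E → F} {P Q : E → H} {x : E}
    (hB : ContDiffAt ℝ ∞ B (f x)) (hf : ContDiffAt ℝ ∞ f x) (hP : ContDiffAt ℝ ∞ P x)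
    (hQ : ContDiffAt ℝ ∞ Q x) : ContDiffAt ℝ ∞ (fun y => B (f y) (P y) (Q y)) x := by
  have h1 : ContDiffAt ℝ ∞ (fun y => B (f y)) x := ContDiffAt.comp (g := B) x hB hf
  exact (h1.clm_apply hP).clm_apply hQ

theorem contDiffAt_fderiv_apply {f : E → F} {W : E → E} {x : E} (hf : ContDiffAt ℝ ∞ f x)
    (hW : ContDiffAt ℝ ∞ W x) : ContDiffAt ℝ ∞ (fun y => fderiv ℝ f y (W y)) x :=
  (hf.fderiv_right (m := ∞) (by simp)).clm_apply hW

theorem fderiv_fderiv_apply {f : E → F} {W : E → E} {x : E} (hf : ContDiffAt ℝ ∞ f x)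
    (hW : DifferentiableAt ℝ W x) (u : E) :
    fderiv ℝ (fun y => fderiv ℝ f y (W y)) x u
      = fderiv ℝ (fderiv ℝ f) x u (W x) + fderiv ℝ f x (fderiv ℝ W x u) := by
  have h : DifferentiableAt ℝ (fderiv ℝ f) x :=
    (hf.fderiv_right (m := ∞) (by simp)).differentiableAt (by simp)
  rw [(h.hasFDerivAt.clm_apply hW.hasFDerivAt).fderiv]
  simp [add_comm]

theorem fderiv_fderiv_comm {f : E → F} {x : E} (hf : ContDiffAt ℝ ∞ f x) (u w : E) :
    fderiv ℝ (fderiv ℝ f) x u w = fderiv ℝ (fderiv ℝ f) x w u :=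
  (hf.isSymmSndFDerivAt (by
    rw [minSmoothness_of_isRCLikeNormedField]; exact WithTop.coe_le_coe.2 (le_top (a := (2 : ℕ∞))))).eq u w

end Generic

/-! ### The covariant Hessian and the curvature tensor -/

section Coordinates

variable {ι : Type} [Fintype ι] [DecidableEq ι]

/-- The covariant Hessian `∇²_{u,w} X = ∇_u ∇_w X - ∇_{∇_u w} X` of a vector field. -/
def hess (g : EuclideanSpace ℝ ι → Matrix ι ι ℝ) (X : EuclideanSpace ℝ ι → EuclideanSpace ℝ ι)
    (x u w : EuclideanSpace ℝ ι) : EuclideanSpace ℝ ι :=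
  covAlong g id (cov g (fun _ => w) X) x u - covAlong g id X x (gam g x u w)

/-- The curvature tensor `R(u,w)v` in terms of the Christoffel symbols. -/
def riem (g : EuclideanSpace ℝ ι → Matrix ι ι ℝ) (x u w v : EuclideanSpace ℝ ι) :
    EuclideanSpace ℝ ι :=
  fderiv ℝ (gamL g) x u w v - fderiv ℝ (gamL g) x w u v
    + gamL g x u (gamL g x w v) - gamL g x w (gamL g x u v)

variable {g : EuclideanSpace ℝ ι → Matrix ι ι ℝ} {V : Set (EuclideanSpace ℝ ι)}
  {x : EuclideanSpace ℝ ι} {X W : EuclideanSpace ℝ ι → EuclideanSpace ℝ ι}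

theorem covAlong_id (Y : EuclideanSpace ℝ ι → EuclideanSpace ℝ ι) (x u : EuclideanSpace ℝ ι) :
    covAlong g id Y x u = fderiv ℝ Y x u + gamL g x u (Y x) := by
  simp [covAlong, gamL_apply]

theorem covAlong_id_add (Y : EuclideanSpace ℝ ι → EuclideanSpace ℝ ι)
    (x u v : EuclideanSpace ℝ ι) :
    covAlong g id Y x (u + v) = covAlong g id Y x u + covAlong g id Y x v := by
  simp only [covAlong_id, map_add, add_apply]
  abel

theorem covAlong_id_smul (Y : EuclideanSpace ℝ ι → EuclideanSpace ℝ ι)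
    (x u : EuclideanSpace ℝ ι) (c : ℝ) :
    covAlong g id Y x (c • u) = c • covAlong g id Y x u := by
  simp only [covAlong_id, map_smul, smul_apply, smul_add]

theorem riem_self (x u v : EuclideanSpace ℝ ι) : riem g x u u v = 0 := by
  simp [riem]

theorem riem_swap (x u w v : EuclideanSpace ℝ ι) : riem g x u w v = -riem g x w u v := by
  simp only [riem]
  abel

theorem riem_add_left (x u u' w v : EuclideanSpace ℝ ι) :
    riem g x (u + u') w v = riem g x u w v + riem g x u' w v := by
  simp only [riem, map_add, add_apply]
  abel

theorem riem_smul_left (x u w v : EuclideanSpace ℝ ι) (c : ℝ) :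
    riem g x (c • u) w v = c • riem g x u w v := by
  simp only [riem, map_smul, smul_apply, smul_add, smul_sub]

theorem riem_add_middle (x u w w' v : EuclideanSpace ℝ ι) :
    riem g x u (w + w') v = riem g x u w v + riem g x u w' v := by
  rw [riem_swap, riem_add_left, riem_swap x w, riem_swap x w']
  abel

theorem riem_smul_middle (x u w v : EuclideanSpace ℝ ι) (c : ℝ) :
    riem g x u (c • w) v = c • riem g x u w v := by
  rw [riem_swap, riem_smul_left, riem_swap x w, smul_neg, neg_neg]

theorem riem_add_right (x u w v v' : EuclideanSpace ℝ ι) :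
    riem g x u w (v + v') = riem g x u w v + riem g x u w v' := by
  simp only [riem, map_add]
  abel

theorem riem_smul_right (x u w v : EuclideanSpace ℝ ι) (c : ℝ) :
    riem g x u w (c • v) = c • riem g x u w v := by
  simp only [riem, map_smul, smul_add, smul_sub]

theorem cov_eq (W X : EuclideanSpace ℝ ι → EuclideanSpace ℝ ι) :
    cov g W X = fun y => fderiv ℝ X y (W y) + gamL g y (W y) (X y) := by
  funext y
  rw [cov, covAlong_id]

namespace IsMetricOn

theorem cov_contDiffAt (hg : IsMetricOn g V) (hx : x ∈ V) (hX : ContDiffAt ℝ ∞ X x)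
    (hW : ContDiffAt ℝ ∞ W x) : ContDiffAt ℝ ∞ (cov g W X) x := by
  rw [cov_eq]
  exact (contDiffAt_fderiv_apply hX hW).add
    (contDiffAt_clm_apply₂ (f := fun y => y) (hg.gamL_contDiffAt hx) contDiffAt_id hW hX)

theorem fderiv_cov (hg : IsMetricOn g V) (hx : x ∈ V) (hX : ContDiffAt ℝ ∞ X x)
    (hW : ContDiffAt ℝ ∞ W x) (u : EuclideanSpace ℝ ι) :
    fderiv ℝ (cov g W X) x u = fderiv ℝ (fderiv ℝ X) x u (W x) + fderiv ℝ X x (fderiv ℝ W x u)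
      + (fderiv ℝ (gamL g) x u (W x) (X x) + gamL g x (fderiv ℝ W x u) (X x)
        + gamL g x (W x) (fderiv ℝ X x u)) := by
  have hX' := hX.differentiableAt (by simp)
  have hW' := hW.differentiableAt (by simp)
  have hG := hg.gamL_differentiableAt hx
  have h1 := fderiv_clm_apply₂ (f := fun y => y) hG differentiableAt_fun_id hW' hX' u
  have h2 := differentiableAt_clm_apply₂ (f := fun y => y) hG differentiableAt_fun_id hW' hX'
  rw [cov_eq, fderiv_fun_add ((contDiffAt_fderiv_apply hX hW).differentiableAt (by simp)) h2,
    add_apply, h1, fderiv_fderiv_apply hX hW']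
  simp

/-- Expands the Hessian so that its antisymmetric part in `u`, `w` is visibly the Christoffel
expression `riem`: the second derivative and the `gam g x u w` term are symmetric, and the mixed
first-order terms exchange places. -/
theorem hess_eq (hg : IsMetricOn g V) (hx : x ∈ V) (hX : ContDiffAt ℝ ∞ X x)
    (u w : EuclideanSpace ℝ ι) :
    hess g X x u w = fderiv ℝ (fderiv ℝ X) x u w + fderiv ℝ (gamL g) x u w (X x)
      + gamL g x w (fderiv ℝ X x u) + gamL g x u (fderiv ℝ X x w + gamL g x w (X x))
      - covAlong g id X x (gam g x u w) := by
  rw [hess, covAlong_id, hg.fderiv_cov hx hX contDiffAt_const]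
  simp [cov_eq]
  abel

/-- The Hessian is tensorial in its second slot, so the constant extension in its definition may be
replaced by any smooth field `W`, at the cost of the derivative of `W`. This brings in the moving
frame. -/
theorem cov_cov (hg : IsMetricOn g V) (hx : x ∈ V) (hX : ContDiffAt ℝ ∞ X x)
    (hW : ContDiffAt ℝ ∞ W x) (u : EuclideanSpace ℝ ι) :
    covAlong g id (cov g W X) x u
      = hess g X x u (W x) + covAlong g id X x (covAlong g id W x u) := by
  rw [hg.hess_eq hx hX, covAlong_id, hg.fderiv_cov hx hX hW, covAlong_id W, covAlong_id_add,
    ← gamL_apply, covAlong_id _ x (fderiv ℝ W x u)]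
  simp only [cov_eq, map_add]
  abel

/-- The Ricci identity. -/
theorem hess_sub_hess (hg : IsMetricOn g V) (hx : x ∈ V) (hX : ContDiffAt ℝ ∞ X x)
    (u w : EuclideanSpace ℝ ι) :
    hess g X x u w - hess g X x w u = riem g x u w (X x) := by
  rw [hg.hess_eq hx hX, hg.hess_eq hx hX, fderiv_fderiv_comm hX w u, hg.gam_comm hx w u, riem]
  simp only [map_add]
  abel

/-- Constant fields commute, so this is the Ricci identity for a constant field. It links the
coordinate definition of the Gaussian curvature to `riem`. -/
theorem curvature_eq (hg : IsMetricOn g V) (hx : x ∈ V) (u w v : EuclideanSpace ℝ ι) :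
    curvature g (fun _ => u) (fun _ => w) (fun _ => v) x = riem g x u w v := by
  have h := hg.hess_sub_hess hx (X := fun _ => v) contDiffAt_const u w
  have h0 : VectorField.lieBracket ℝ (fun _ : EuclideanSpace ℝ ι => u) (fun _ => w) x = 0 := by
    simp [VectorField.lieBracket]
  rw [← h, curvature]
  simp only [cov, hess, h0, hg.gam_comm hx w u]
  rw [covAlong_id _ x 0]
  simp

/-- Differentiate the function `⟨a, a⟩` twice, for a constant field `a`. Its second derivative is
symmetric, and so are the products of first covariant derivatives; what remains after
antisymmetrizing is `⟨R(u,w)a, a⟩`. -/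
theorem dot_riem_self (hg : IsMetricOn g V) (hx : x ∈ V) (u w a : EuclideanSpace ℝ ι) :
    dot (g x) (riem g x u w a) a = 0 := by
  have hs : ContDiffAt ℝ ∞ (fun y => dot (g y) a a) x := by
    simp only [← dotL_apply]
    exact contDiffAt_clm_apply₂ (f := fun y => y) (B := fun y => dotL (g y))
      (hg.dotL_contDiffAt hx) contDiffAt_id contDiffAt_const contDiffAt_const
  have h1 : ∀ w, ∀ y ∈ V, fderiv ℝ (fun y => dot (g y) a a) y w
      = 2 * dot (g y) (cov g (fun _ => w) (fun _ => a) y) a := by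
    intro w y hy
    have h := hg.fderiv_dot (f := id) (P := fun _ => a) (Q := fun _ => a) (z := y) hy
      differentiableAt_id (differentiableAt_const _) (differentiableAt_const _) w
    simp only [id] at h
    rw [h, dot_comm (hg.symm y hy) a, cov]
    ring
  have h2 : ∀ u w, fderiv ℝ (fderiv ℝ (fun y => dot (g y) a a)) x u w
      = 2 * (dot (g x) (covAlong g id (cov g (fun _ => w) (fun _ => a)) x u) a
        + dot (g x) (cov g (fun _ => w) (fun _ => a) x) (cov g (fun _ => u) (fun _ => a) x)) := by
    intro u w
    have h3 := fderiv_fderiv_apply hs (differentiableAt_const w) u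
    have h4 : (fun y => fderiv ℝ (fun y => dot (g y) a a) y w)
        =ᶠ[nhds x] fun y => 2 * dot (g y) (cov g (fun _ => w) (fun _ => a) y) a := by
      filter_upwards [hg.eventually_mem hx] with y hy using h1 w y hy
    have h5 : DifferentiableAt ℝ (cov g (fun _ => w) (fun _ => a)) x :=
      (hg.cov_contDiffAt hx contDiffAt_const contDiffAt_const).differentiableAt (by simp)
    have h6 : DifferentiableAt ℝ
        (fun y => dot (g y) (cov g (fun _ => w) (fun _ => a) y) a) x := by
      simp only [← dotL_apply]
      exact differentiableAt_clm_apply₂ (f := fun y => y) (B := fun y => dotL (g y))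
        (hg.dotL_differentiableAt hx) differentiableAt_fun_id h5 (differentiableAt_const _)
    have h7 := hg.fderiv_dot (f := id) (z := x) hx differentiableAt_id h5
      (differentiableAt_const a) u
    simp only [id_eq] at h7
    rw [h4.fderiv_eq, fderiv_const_mul h6] at h3
    simp only [smul_apply, h7, smul_eq_mul] at h3
    simpa [cov] using h3.symm
  have h8 := hg.hess_sub_hess hx (X := fun _ => a) contDiffAt_const u w
  have h9 := fderiv_fderiv_comm hs u w
  rw [h2, h2, dot_comm (hg.symm x hx) (cov g (fun _ => u) (fun _ => a) x)] at h9
  simp only [hess, hg.gam_comm hx w u, sub_sub_sub_cancel_right] at h8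
  rw [← h8, ← dotL_apply, map_sub, sub_apply, dotL_apply, dotL_apply]
  linarith

theorem dot_riem_swap (hg : IsMetricOn g V) (hx : x ∈ V) (u w a b : EuclideanSpace ℝ ι) :
    dot (g x) (riem g x u w a) b = -dot (g x) (riem g x u w b) a := by
  have h := hg.dot_riem_self hx u w (a + b)
  have ha := hg.dot_riem_self hx u w a
  have hb := hg.dot_riem_self hx u w b
  simp only [riem_add_right, ← dotL_apply, map_add, add_apply] at h ha hb ⊢
  linarith

end IsMetricOn

end Coordinates

/-! ### The Sasaki metric and its Levi-Civita connection -/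

section Coordinates

variable {ι : Type}

@[simp] theorem base_pair (u v : EuclideanSpace ℝ ι) : base (pair u v) = u := rfl

@[simp] theorem fibre_pair (u v : EuclideanSpace ℝ ι) : fibre (pair u v) = v := rfl

theorem base_vertLift (u : EuclideanSpace ℝ ι) : base (vertLift u) = 0 := rfl

theorem base_toTM (X : EuclideanSpace ℝ ι → EuclideanSpace ℝ ι) (x : EuclideanSpace ℝ ι) :
    base (toTM X x) = x := rfl

theorem fibre_toTM (X : EuclideanSpace ℝ ι → EuclideanSpace ℝ ι) (x : EuclideanSpace ℝ ι) :
    fibre (toTM X x) = X x := rfl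

variable [Fintype ι]

/-- The base block as a continuous linear map. -/
def baseL : EuclideanSpace ℝ (ι ⊕ ι) →L[ℝ] EuclideanSpace ℝ ι :=
  LinearMap.toContinuousLinearMap
    { toFun := base, map_add' := fun _ _ => rfl, map_smul' := fun _ _ => rfl }

/-- The fibre block as a continuous linear map. -/
def fibreL : EuclideanSpace ℝ (ι ⊕ ι) →L[ℝ] EuclideanSpace ℝ ι :=
  LinearMap.toContinuousLinearMap
    { toFun := fibre, map_add' := fun _ _ => rfl, map_smul' := fun _ _ => rfl }

/-- The pairing of base and fibre blocks as a continuous linear map. -/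
def pairL : EuclideanSpace ℝ ι × EuclideanSpace ℝ ι →L[ℝ] EuclideanSpace ℝ (ι ⊕ ι) :=
  LinearMap.toContinuousLinearMap
    { toFun := fun p => pair p.1 p.2
      map_add' := fun _ _ => by ext (i | i) <;> rfl
      map_smul' := fun _ _ => by ext (i | i) <;> rfl }

theorem baseL_apply (z : EuclideanSpace ℝ (ι ⊕ ι)) : baseL z = base z := rfl

theorem fibreL_apply (z : EuclideanSpace ℝ (ι ⊕ ι)) : fibreL z = fibre z := rfl

theorem contDiffAt_base (z : EuclideanSpace ℝ (ι ⊕ ι)) : ContDiffAt ℝ ∞ base z :=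
  (baseL : _ →L[ℝ] EuclideanSpace ℝ ι).contDiff.contDiffAt

theorem contDiffAt_fibre (z : EuclideanSpace ℝ (ι ⊕ ι)) : ContDiffAt ℝ ∞ fibre z :=
  (fibreL : _ →L[ℝ] EuclideanSpace ℝ ι).contDiff.contDiffAt

theorem fderiv_toTM {X : EuclideanSpace ℝ ι → EuclideanSpace ℝ ι} {x : EuclideanSpace ℝ ι}
    (hX : DifferentiableAt ℝ X x) (u : EuclideanSpace ℝ ι) :
    fderiv ℝ (toTM X) x u = pair u (fderiv ℝ X x u) := by
  have h : HasFDerivAt (toTM X) (pairL.comp ((ContinuousLinearMap.id ℝ _).prod (fderiv ℝ X x))) x :=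
    (pairL : _ →L[ℝ] EuclideanSpace ℝ (ι ⊕ ι)).hasFDerivAt.comp x
      ((hasFDerivAt_id x).prodMk hX.hasFDerivAt)
  rw [h.fderiv]
  rfl

theorem fderiv_fderiv_toTM {X : EuclideanSpace ℝ ι → EuclideanSpace ℝ ι} {x : EuclideanSpace ℝ ι}
    (hX : ContDiffAt ℝ ∞ X x) (u w : EuclideanSpace ℝ ι) :
    fderiv ℝ (fun y => fderiv ℝ (toTM X) y w) x u = pair 0 (fderiv ℝ (fderiv ℝ X) x u w) := by
  have h0 : (fun y => fderiv ℝ (toTM X) y w)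
      =ᶠ[nhds x] fun y => pairL (w, fderiv ℝ X y w) := by
    have h1 : ∀ᶠ y in nhds x, ContDiffAt ℝ 1 X y :=
      (hX.of_le (by simp)).eventually (by simp)
    filter_upwards [h1] with y hy
    rw [fderiv_toTM (hy.differentiableAt (by simp))]
    rfl
  have h2 : DifferentiableAt ℝ (fun y => fderiv ℝ X y w) x :=
    (contDiffAt_fderiv_apply hX contDiffAt_const).differentiableAt (by simp)
  have h3 : HasFDerivAt (fun y => pairL (w, fderiv ℝ X y w))
      (pairL.comp ((0 : EuclideanSpace ℝ ι →L[ℝ] EuclideanSpace ℝ ι).prod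
        (fderiv ℝ (fun y => fderiv ℝ X y w) x))) x :=
    (pairL : _ →L[ℝ] EuclideanSpace ℝ (ι ⊕ ι)).hasFDerivAt.comp x
      ((hasFDerivAt_const w x).prodMk h2.hasFDerivAt)
  rw [h0.fderiv_eq, h3.fderiv]
  have h4 := fderiv_fderiv_apply hX (differentiableAt_const w) u
  simp only [fderiv_fun_const, Pi.zero_apply, zero_apply, map_zero, add_zero] at h4
  rw [← h4]
  rfl

variable [DecidableEq ι] {g : EuclideanSpace ℝ ι → Matrix ι ι ℝ} {V : Set (EuclideanSpace ℝ ι)}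

variable (g) in
/-- The connection map at a point as a continuous linear map. -/
def connectorL (z : EuclideanSpace ℝ (ι ⊕ ι)) :
    EuclideanSpace ℝ (ι ⊕ ι) →L[ℝ] EuclideanSpace ℝ ι :=
  fibreL + ((gamL g (base z)).flip (fibre z)).comp baseL

theorem connectorL_apply (z A : EuclideanSpace ℝ (ι ⊕ ι)) :
    connectorL g z A = connector g z A := by
  simp [connectorL, connector, fibreL_apply, baseL_apply, gamL_apply]

theorem connector_horLift (z : EuclideanSpace ℝ (ι ⊕ ι)) (u : EuclideanSpace ℝ ι) :
    connector g z (horLift g z u) = 0 := by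
  simp [connector, horLift]

theorem connector_vertLift (z : EuclideanSpace ℝ (ι ⊕ ι)) (u : EuclideanSpace ℝ ι) :
    connector g z (vertLift u) = u := by
  simp [connector, vertLift, ← gamL_apply]

theorem base_horLift (z : EuclideanSpace ℝ (ι ⊕ ι)) (u : EuclideanSpace ℝ ι) :
    base (horLift g z u) = u := rfl

theorem dot_sasaki (z A B : EuclideanSpace ℝ (ι ⊕ ι)) :
    dot (sasaki g z) A B = dot (g (base z)) (base A) (base B)
      + dot (g (base z)) (connector g z A) (connector g z B) := by
  have h := dot_of_bilin ((dotL (g (base z))).bilinearComp baseL baseL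
    + (dotL (g (base z))).bilinearComp (connectorL g z) (connectorL g z)) A B
  simpa [connectorL_apply, baseL_apply, dotL_apply, sasaki] using h

theorem sasaki_apply (z : EuclideanSpace ℝ (ι ⊕ ι)) (a b : ι ⊕ ι) :
    sasaki g z a b = dotL (g (base z)) (base (basisVec a)) (base (basisVec b))
      + dotL (g (base z)) (connector g z (basisVec a)) (connector g z (basisVec b)) := by
  simp [sasaki, dotL_apply]

namespace IsMetricOn

theorem dot_nondegenerate {x : EuclideanSpace ℝ ι} (hg : IsMetricOn g V) (hx : x ∈ V)
    {v : EuclideanSpace ℝ ι} (h : ∀ w, dot (g x) v w = 0) : v = 0 := by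
  by_contra hv
  refine hg.det_ne x hx (Matrix.exists_vecMul_eq_zero_iff.1 ⟨v.ofLp, ?_, ?_⟩)
  · intro h0
    exact hv (by ext i; exact congrFun h0 i)
  · ext j
    have := h (basisVec j)
    simpa [dot, basisVec, Matrix.vecMul, dotProduct, Pi.single_apply, mul_comm] using this

theorem connector_contDiffAt (hg : IsMetricOn g V) {z : EuclideanSpace ℝ (ι ⊕ ι)}
    (hz : base z ∈ V) (A : EuclideanSpace ℝ (ι ⊕ ι)) :
    ContDiffAt ℝ ∞ (fun y => connector g y A) z := by
  simp only [connector, ← gamL_apply]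
  exact contDiffAt_const.add (contDiffAt_clm_apply₂ (f := base) (hg.gamL_contDiffAt hz)
    (contDiffAt_base z) contDiffAt_const (contDiffAt_fibre z))

theorem sasaki_isMetricOn (hg : IsMetricOn g V) : IsMetricOn (sasaki g) (base ⁻¹' V) where
  isOpen := hg.isOpen.preimage baseL.continuous
  smooth z hz a b := by
    simp only [sasaki_apply]
    exact (contDiffAt_clm_apply₂ (B := fun y => dotL (g y)) (f := base) (hg.dotL_contDiffAt hz)
      (contDiffAt_base z) contDiffAt_const contDiffAt_const).add
      (contDiffAt_clm_apply₂ (B := fun y => dotL (g y)) (f := base) (hg.dotL_contDiffAt hz)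
      (contDiffAt_base z) (hg.connector_contDiffAt hz _) (hg.connector_contDiffAt hz _))
  symm z hz a b := by
    simp only [sasaki_apply, dotL_apply]
    rw [dot_comm (hg.symm _ hz), dot_comm (hg.symm _ hz) (connector g z (basisVec a))]
  det_ne z hz h := by
    obtain ⟨v, hv, hv0⟩ := Matrix.exists_vecMul_eq_zero_iff.2 h
    have h0 : ∀ B, dot (sasaki g z) (WithLp.toLp 2 v) B = 0 := by
      intro B
      have : dot (sasaki g z) (WithLp.toLp 2 v) B
          = ∑ j, (Matrix.vecMul v (sasaki g z)) j * B j := by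
        simp only [dot, Matrix.vecMul, dotProduct, Finset.sum_mul]
        rw [Finset.sum_comm]
        exact Finset.sum_congr rfl fun i _ => Finset.sum_congr rfl fun j _ => by ring
      rw [this, hv0]
      simp
    -- A vector in the kernel is tested against horizontal lifts, which see only its base block, and
    -- below against vertical lifts, which see only its connector.
    have h1 : base (WithLp.toLp 2 v) = 0 := hg.dot_nondegenerate hz fun w => by
      have := h0 (horLift g z w)
      rw [dot_sasaki, connector_horLift, base_horLift] at this
      simpa [← dotL_apply] using this
    have h2 : connector g z (WithLp.toLp 2 v) = 0 := hg.dot_nondegenerate hz fun w => by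
      have := h0 (vertLift w)
      rw [dot_sasaki, connector_vertLift, base_vertLift] at this
      simpa [← dotL_apply] using this
    have h3 : WithLp.toLp 2 v = (0 : EuclideanSpace ℝ (ι ⊕ ι)) := by
      rw [← horLift_add_vertLift g z (WithLp.toLp 2 v), h1, h2]
      ext (i | i) <;> simp [horLift, vertLift, pair, ← gamL_apply]
    exact hv (by simpa using congrArg WithLp.ofLp h3)

theorem covAlong_connector (hg : IsMetricOn g V) {z : EuclideanSpace ℝ (ι ⊕ ι)}
    (hz : base z ∈ V) (A B : EuclideanSpace ℝ (ι ⊕ ι)) :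
    covAlong g base (fun y => connector g y B) z A
      = fderiv ℝ (gamL g) (base z) (base A) (base B) (fibre z)
        + gamL g (base z) (base B) (fibre A) + gamL g (base z) (base A) (connector g z B) := by
  have hb : fderiv ℝ base z = (baseL : _ →L[ℝ] EuclideanSpace ℝ ι) := baseL.fderiv
  have hf : fderiv ℝ fibre z = (fibreL : _ →L[ℝ] EuclideanSpace ℝ ι) := fibreL.fderiv
  have h := fderiv_clm_apply₂ (f := base) (P := fun _ => base B) (Q := fibre)
    (hg.gamL_differentiableAt hz) baseL.differentiableAt (differentiableAt_const _)
    fibreL.differentiableAt A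
  rw [covAlong, hb]
  simp only [connector, ← gamL_apply]
  rw [fderiv_const_add, h, hb, hf]
  simp [baseL_apply, fibreL_apply]

/-- The structure equation of the connection map: the failure of horizontal spaces to be integrable
is the curvature. This is the only source of curvature in the Sasaki connection. -/
theorem covAlong_connector_sub (hg : IsMetricOn g V) {z : EuclideanSpace ℝ (ι ⊕ ι)}
    (hz : base z ∈ V) (A B : EuclideanSpace ℝ (ι ⊕ ι)) :
    covAlong g base (fun y => connector g y B) z A
      - covAlong g base (fun y => connector g y A) z B
      = riem g (base z) (base A) (base B) (fibre z) := by
  rw [hg.covAlong_connector hz, hg.covAlong_connector hz, riem]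
  simp only [connector, map_add, ← gamL_apply]
  abel

/-- Both summands of the Sasaki metric are scalar products of fields along the bundle projection, so
compatibility of the base connection differentiates each of them. -/
theorem fderiv_dotL_sasaki (hg : IsMetricOn g V) {z : EuclideanSpace ℝ (ι ⊕ ι)}
    (hz : base z ∈ V) (A B C : EuclideanSpace ℝ (ι ⊕ ι)) :
    fderiv ℝ (fun y => dotL (sasaki g y)) z A B C
      = dot (g (base z)) (gam g (base z) (base A) (base B)) (base C)
        + dot (g (base z)) (base B) (gam g (base z) (base A) (base C))
        + (dot (g (base z)) (covAlong g base (fun y => connector g y B) z A) (connector g z C)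
        + dot (g (base z)) (connector g z B)
          (covAlong g base (fun y => connector g y C) z A)) := by
  have hb : fderiv ℝ base z = (baseL : _ →L[ℝ] EuclideanSpace ℝ ι) := baseL.fderiv
  have hbd : DifferentiableAt ℝ base z :=
    (baseL : _ →L[ℝ] EuclideanSpace ℝ ι).differentiableAt
  have hk : ∀ A, DifferentiableAt ℝ (fun y => connector g y A) z := fun A =>
    (hg.connector_contDiffAt hz A).differentiableAt (by simp)
  have hS := hg.sasaki_isMetricOn
  have h0 := fderiv_clm_apply₂ (B := fun y => dotL (sasaki g y)) (f := fun y => y)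
    (P := fun _ => B) (Q := fun _ => C) (hS.dotL_differentiableAt (x := z) hz)
    differentiableAt_fun_id (differentiableAt_const _) (differentiableAt_const _) A
  have h1 := hg.fderiv_dot hz hbd (differentiableAt_const (base B))
    (differentiableAt_const (base C)) A
  have h2 := hg.fderiv_dot hz hbd (hk B) (hk C) A
  have hd : ∀ {P Q : EuclideanSpace ℝ (ι ⊕ ι) → EuclideanSpace ℝ ι}, DifferentiableAt ℝ P z →
      DifferentiableAt ℝ Q z → DifferentiableAt ℝ (fun y => dot (g (base y)) (P y) (Q y)) z := by
    intro P Q hP hQ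
    simp only [← dotL_apply]
    exact differentiableAt_clm_apply₂ (B := fun y => dotL (g y)) (hg.dotL_differentiableAt hz)
      hbd hP hQ
  simp only [fderiv_fun_id, ContinuousLinearMap.id_apply, fderiv_fun_const, Pi.zero_apply,
    zero_apply, map_zero, add_zero] at h0
  simp only [dotL_apply, dot_sasaki] at h0
  rw [fderiv_fun_add (hd (differentiableAt_const _) (differentiableAt_const _))
    (hd (hk B) (hk C)), add_apply, h1, h2] at h0
  simp only [covAlong, fderiv_fun_const, Pi.zero_apply, zero_apply, zero_add, hb,
    baseL_apply] at h0
  rw [← h0]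
  simp only [covAlong, hb, baseL_apply]

/-- The Christoffel symbols of the Sasaki metric. -/
theorem dot_gam_sasaki (hg : IsMetricOn g V) {z : EuclideanSpace ℝ (ι ⊕ ι)}
    (hz : base z ∈ V) (A B C : EuclideanSpace ℝ (ι ⊕ ι)) :
    dot (sasaki g z) (gam (sasaki g) z A B) C
      = dot (g (base z)) (gam g (base z) (base A) (base B)) (base C)
        + (1 / 2) * (dot (g (base z)) (covAlong g base (fun y => connector g y B) z A)
            (connector g z C)
          + dot (g (base z)) (covAlong g base (fun y => connector g y A) z B) (connector g z C))
        + (1 / 2) * (dot (g (base z)) (connector g z B)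
            (riem g (base z) (base A) (base C) (fibre z))
          + dot (g (base z)) (connector g z A)
            (riem g (base z) (base B) (base C) (fibre z))) := by
  have hc := hg.gam_comm hz
  have hs := dot_comm (hg.symm _ hz)
  -- In Koszul's formula the terms paired with `connector g z A` and `connector g z B` are
  -- antisymmetrized derivatives of the connection map, hence curvatures; those paired with
  -- `connector g z C` stay symmetrized.
  rw [hg.sasaki_isMetricOn.dot_gam (x := z) hz, hg.fderiv_dotL_sasaki hz,
    hg.fderiv_dotL_sasaki hz, hg.fderiv_dotL_sasaki hz, ← hg.covAlong_connector_sub hz A C,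
    ← hg.covAlong_connector_sub hz B C, hc (base B) (base A), hc (base C) (base A),
    hc (base C) (base B), hs (base B) (gam g (base z) (base A) (base C)),
    hs (base A) (gam g (base z) (base B) (base C)),
    hs (covAlong g base (fun y => connector g y A) z C)]
  simp only [← dotL_apply, map_sub]
  simp only [dotL_apply]
  ring

end IsMetricOn

theorem connector_fderiv_toTM {X : EuclideanSpace ℝ ι → EuclideanSpace ℝ ι}
    {x : EuclideanSpace ℝ ι} (hX : DifferentiableAt ℝ X x) (u : EuclideanSpace ℝ ι) :
    connector g (toTM X x) (fderiv ℝ (toTM X) x u) = covAlong g id X x u := by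
  rw [fderiv_toTM hX, covAlong_id, gamL_apply]
  rfl

namespace IsMetricOn

variable {x : EuclideanSpace ℝ ι} {X : EuclideanSpace ℝ ι → EuclideanSpace ℝ ι}

/-- The second fundamental form of the image of a vector field in the unit tangent bundle. -/
theorem secondForm_eq (hg : IsMetricOn g V) (hx : x ∈ V) (hX : ContDiffAt ℝ ∞ X x)
    {n : EuclideanSpace ℝ (ι ⊕ ι)} (hn : dot (sasaki g (toTM X x)) n (vertLift (X x)) = 0)
    (u w : EuclideanSpace ℝ ι) :
    secondForm g (toTM X) x n u w = dot (g x) (gam g x u w) (base n)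
      + dot (g x) (covAlong g id X x (gam g x u w)) (connector g (toTM X x) n)
      + (1 / 2) * dot (g x) (hess g X x u w + hess g X x w u) (connector g (toTM X x) n)
      + (1 / 2) * (dot (g x) (covAlong g id X x w) (riem g x u (base n) (X x))
        + dot (g x) (covAlong g id X x u) (riem g x w (base n) (X x))) := by
  have hXd : DifferentiableAt ℝ X x := hX.differentiableAt (by simp)
  have hz : base (toTM X x) ∈ V := hx
  -- Removes the correction term of `unitProj`.
  have hn' : dot (sasaki g (toTM X x)) (vertLift (X x)) n = 0 := by
    rw [dot_comm (hg.sasaki_isMetricOn.symm _ hz), hn]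
  -- The derivative of the connection map and the plain second derivative of `X` combine into a
  -- tensorial Hessian plus a term depending on the coordinates only through `gam g x u w`.
  have hC : ∀ u w, covAlong g base
      (fun y => connector g y (fderiv ℝ (toTM X) x w)) (toTM X x) (fderiv ℝ (toTM X) x u)
      + fderiv ℝ (fderiv ℝ X) x u w
      = hess g X x u w + covAlong g id X x (gam g x u w) := by
    intro u w
    rw [hg.covAlong_connector hz, connector_fderiv_toTM hXd, covAlong_id X x w,
      hg.hess_eq hx hX, fderiv_toTM hXd, fderiv_toTM hXd]
    simp only [base_toTM, fibre_toTM, base_pair, fibre_pair]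
    abel
  have h1 := hC u w
  have h2 := hC w u
  rw [fderiv_fderiv_comm hX w u, hg.gam_comm hx w u] at h2
  have h3 := hg.dot_gam_sasaki hz (fderiv ℝ (toTM X) x u) (fderiv ℝ (toTM X) x w) n
  rw [secondForm, unitCovAlong, unitProj, covAlong, fderiv_fderiv_toTM hX, fibre_toTM,
    ← dotL_apply, map_sub, map_smul, sub_apply, smul_apply, map_add, add_apply, dotL_apply,
    dotL_apply, dotL_apply _ (vertLift _), hn', smul_zero, sub_zero, h3, dot_sasaki,
    eq_sub_of_add_eq h1, eq_sub_of_add_eq h2, connector_fderiv_toTM hXd,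
    connector_fderiv_toTM hXd, fderiv_toTM hXd, fderiv_toTM hXd]
  have h4 : connector g (toTM X x) (pair 0 (fderiv ℝ (fderiv ℝ X) x u w))
      = fderiv ℝ (fderiv ℝ X) x u w := connector_vertLift _ _
  simp only [base_toTM, fibre_toTM, base_pair, h4]
  simp only [← dotL_apply, map_add, map_sub, map_zero, add_apply, sub_apply, zero_apply]
  ring

end IsMetricOn

end Coordinates

/-! ### Surfaces: curvature and the frames adapted to `ξ` -/

section Plane

variable {g : EuclideanSpace ℝ (Fin 2) → Matrix (Fin 2) (Fin 2) ℝ}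
  {V : Set (EuclideanSpace ℝ (Fin 2))} {x : EuclideanSpace ℝ (Fin 2)}

/-- Multiplicativity of determinants for the matrix of mutual scalar products. It turns the
orientation test into coordinate areas. -/
theorem dot_mul_dot_sub (a : Matrix (Fin 2) (Fin 2) ℝ) (p q v w : EuclideanSpace ℝ (Fin 2)) :
    dot a p v * dot a q w - dot a p w * dot a q v
      = a.det * (p 0 * q 1 - p 1 * q 0) * (v 0 * w 1 - v 1 * w 0) := by
  simp only [dot, Fin.sum_univ_two, Matrix.det_fin_two]
  ring

/-- The expansion of a vector in an orthonormal basis of the plane. -/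
theorem eq_dot_smul_add {a : Matrix (Fin 2) (Fin 2) ℝ} (ha : ∀ i j, a i j = a j i)
    {p q : EuclideanSpace ℝ (Fin 2)} (hp : dot a p p = 1) (hq : dot a q q = 1)
    (hpq : dot a p q = 0) (v : EuclideanSpace ℝ (Fin 2)) :
    v = dot a v p • p + dot a v q • q := by
  have h : Matrix.of ![![dot a p p, dot a p q], ![dot a q p, dot a q q]] = 1 := by
    rw [hp, hq, hpq, dot_comm ha q, hpq]
    ext i j
    fin_cases i <;> fin_cases j <;> rfl
  have h1 : Matrix.of ![![dot a p p, dot a p q], ![dot a q p, dot a q q]]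
      = Matrix.of ![p, q] * (a * (Matrix.of ![p, q]).transpose) := by
    ext i j
    fin_cases i <;> fin_cases j <;>
      simp [dot, Matrix.mul_apply, Fin.sum_univ_two] <;> ring
  -- The Gram matrix factors as `P (a Pᵀ) = 1` with rows `p`, `q`. A left inverse of a square matrix
  -- is a right inverse, and the entries of `(a Pᵀ) P = 1` are the coordinate expansion.
  rw [h1, mul_eq_one_comm] at h
  have h2 : ∀ i j, (a * (Matrix.of ![p, q]).transpose * Matrix.of ![p, q]) i j
      = (1 : Matrix (Fin 2) (Fin 2) ℝ) i j := fun i j => by rw [h]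
  have h00 := h2 0 0
  have h01 := h2 0 1
  have h10 := h2 1 0
  have h11 := h2 1 1
  simp [Matrix.mul_apply, Fin.sum_univ_two] at h00 h01 h10 h11
  ext i
  fin_cases i
  · simp [dot, Fin.sum_univ_two]
    rw [ha 1 0] at *
    linear_combination (-(v 0)) * h00 - v 1 * h10
  · simp [dot, Fin.sum_univ_two]
    rw [ha 1 0] at *
    linear_combination (-(v 0)) * h01 - v 1 * h11

namespace IsMetricOn

/-- The curvature is skew in each of its two pairs of arguments, and the space of bivectors of a
plane is one-dimensional. -/
theorem dot_riem_plane (hg : IsMetricOn g V) (hx : x ∈ V) (u w a b : EuclideanSpace ℝ (Fin 2)) :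
    dot (g x) (riem g x u w a) b
      = (u 0 * w 1 - u 1 * w 0) * (a 0 * b 1 - a 1 * b 0)
        * dot (g x) (riem g x (basisVec 0) (basisVec 1) (basisVec 0)) (basisVec 1) := by
  have hb : ∀ v : EuclideanSpace ℝ (Fin 2), v = v 0 • basisVec 0 + v 1 • basisVec 1 := fun v => by
    conv_lhs => rw [← sum_smul_basisVec v, Fin.sum_univ_two]
  have h0 := hg.dot_riem_self hx (basisVec 0) (basisVec 1) (basisVec 0)
  have h1 := hg.dot_riem_self hx (basisVec 0) (basisVec 1) (basisVec 1)
  have h2 := hg.dot_riem_swap hx (basisVec 0) (basisVec 1) (basisVec 1) (basisVec 0)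
  have h3 : riem g x u w a
      = (u 0 * w 1 - u 1 * w 0) • riem g x (basisVec 0) (basisVec 1) a := by
    conv_lhs => rw [hb u, hb w]
    simp only [riem_add_left, riem_add_middle, riem_smul_left, riem_smul_middle, riem_self]
    rw [riem_swap x (basisVec 1) (basisVec 0)]
    module
  rw [h3]
  conv_lhs => rw [hb a, hb b]
  simp only [riem_add_right, riem_smul_right, ← dotL_apply, map_add, map_smul, add_apply,
    smul_apply, smul_eq_mul] at h0 h1 h2 ⊢
  rw [h0, h1, h2]
  ring

theorem gaussCurvature_mul_det (hg : IsMetricOn g V) (hx : x ∈ V) :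
    gaussCurvature g x * (g x).det
      = -dot (g x) (riem g x (basisVec 0) (basisVec 1) (basisVec 0)) (basisVec 1) := by
  rw [gaussCurvature, hg.curvature_eq hx, hg.dot_riem_swap hx, div_mul_cancel₀ _ (hg.det_ne x hx)]

end IsMetricOn

/-- Smooth orthonormal frames `(ξ, η)` and `(e₀, e₁)` on `V` with `∇_{e₀} ξ = 0`. -/
structure IsParallelFrame (g : EuclideanSpace ℝ (Fin 2) → Matrix (Fin 2) (Fin 2) ℝ)
    (V : Set (EuclideanSpace ℝ (Fin 2)))
    (ξ η e₀ e₁ : EuclideanSpace ℝ (Fin 2) → EuclideanSpace ℝ (Fin 2)) : Prop where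
  metric : IsMetricOn g V
  smooth_ξ : ∀ y ∈ V, ContDiffAt ℝ ∞ ξ y
  smooth_η : ∀ y ∈ V, ContDiffAt ℝ ∞ η y
  smooth_e₀ : ∀ y ∈ V, ContDiffAt ℝ ∞ e₀ y
  smooth_e₁ : ∀ y ∈ V, ContDiffAt ℝ ∞ e₁ y
  ξξ : ∀ y ∈ V, dot (g y) (ξ y) (ξ y) = 1
  ηη : ∀ y ∈ V, dot (g y) (η y) (η y) = 1
  ξη : ∀ y ∈ V, dot (g y) (ξ y) (η y) = 0
  e₀e₀ : ∀ y ∈ V, dot (g y) (e₀ y) (e₀ y) = 1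
  e₁e₁ : ∀ y ∈ V, dot (g y) (e₁ y) (e₁ y) = 1
  e₀e₁ : ∀ y ∈ V, dot (g y) (e₀ y) (e₁ y) = 0
  parallel : ∀ y ∈ V, cov g e₀ ξ y = 0

theorem IsMetricOn.dot_cov_add (hg : IsMetricOn g V) (hx : x ∈ V)
    {P Q : EuclideanSpace ℝ (Fin 2) → EuclideanSpace ℝ (Fin 2)} (hP : ContDiffAt ℝ ∞ P x)
    (hQ : ContDiffAt ℝ ∞ Q x) {c : ℝ} (h : ∀ y ∈ V, dot (g y) (P y) (Q y) = c)
    (u : EuclideanSpace ℝ (Fin 2)) :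
    dot (g x) (covAlong g id P x u) (Q x) + dot (g x) (P x) (covAlong g id Q x u) = 0 := by
  have h1 := hg.fderiv_dot (f := id) (z := x) hx differentiableAt_id
    (hP.differentiableAt (by simp)) (hQ.differentiableAt (by simp)) u
  have h2 : (fun y => dot (g (id y)) (P y) (Q y)) =ᶠ[nhds x] fun _ => c := by
    filter_upwards [hg.eventually_mem hx] with y hy using h y hy
  rw [h2.fderiv_eq] at h1
  simpa using h1.symm

namespace IsParallelFrame

variable {ξ η e₀ e₁ : EuclideanSpace ℝ (Fin 2) → EuclideanSpace ℝ (Fin 2)}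

theorem dot_symm (h : IsParallelFrame g V ξ η e₀ e₁) (hx : x ∈ V)
    (v w : EuclideanSpace ℝ (Fin 2)) : dot (g x) v w = dot (g x) w v :=
  dot_comm (h.metric.symm x hx) v w

/-- Only the `e₁`-component of `v` contributes, because `ξ` is parallel along `e₀`; the result is a
multiple of `η` because `ξ` has unit length. -/
theorem cov_ξ (h : IsParallelFrame g V ξ η e₀ e₁) (hx : x ∈ V) (v : EuclideanSpace ℝ (Fin 2)) :
    covAlong g id ξ x v = (dot (g x) v (e₁ x) * lam g ξ η e₁ x) • η x := by
  have h1 : dot (g x) (covAlong g id ξ x (e₁ x)) (ξ x) = 0 := by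
    have := h.metric.dot_cov_add hx (h.smooth_ξ x hx) (h.smooth_ξ x hx) h.ξξ (e₁ x)
    rw [h.dot_symm hx (ξ x)] at this
    linarith
  have h2 := eq_dot_smul_add (h.metric.symm x hx) (h.ξξ x hx) (h.ηη x hx) (h.ξη x hx)
    (covAlong g id ξ x (e₁ x))
  have h3 : covAlong g id ξ x (e₀ x) = 0 := h.parallel x hx
  have h4 := eq_dot_smul_add (h.metric.symm x hx) (h.e₀e₀ x hx) (h.e₁e₁ x hx) (h.e₀e₁ x hx) v
  have h5 : covAlong g id ξ x (e₁ x) = lam g ξ η e₁ x • η x := by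
    conv_lhs => rw [h2, h1, zero_smul, zero_add]
    rfl
  conv_lhs => rw [h4]
  rw [covAlong_id_add, covAlong_id_smul, covAlong_id_smul, h3, h5, smul_zero, zero_add, smul_smul]

theorem lam_contDiffAt (h : IsParallelFrame g V ξ η e₀ e₁) (hx : x ∈ V) :
    ContDiffAt ℝ ∞ (lam g ξ η e₁) x := by
  unfold lam
  simp only [← dotL_apply]
  exact contDiffAt_clm_apply₂ (f := fun y => y) (B := fun y => dotL (g y))
    (h.metric.dotL_contDiffAt hx) contDiffAt_id
    (h.metric.cov_contDiffAt hx (h.smooth_ξ x hx) (h.smooth_e₁ x hx)) (h.smooth_η x hx)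

theorem dot_cov_η (h : IsParallelFrame g V ξ η e₀ e₁) (hx : x ∈ V)
    (v : EuclideanSpace ℝ (Fin 2)) : dot (g x) (covAlong g id η x v) (η x) = 0 := by
  have := h.metric.dot_cov_add hx (h.smooth_η x hx) (h.smooth_η x hx) h.ηη v
  rw [h.dot_symm hx (η x)] at this
  linarith

/-- The other Leibniz term vanishes: `∇ξ` is a multiple of `η`, while `∇η` is orthogonal to `η`. -/
theorem fderiv_lam (h : IsParallelFrame g V ξ η e₀ e₁) (hx : x ∈ V)
    (v : EuclideanSpace ℝ (Fin 2)) :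
    fderiv ℝ (lam g ξ η e₁) x v = dot (g x) (covAlong g id (cov g e₁ ξ) x v) (η x) := by
  have h1 := h.metric.fderiv_dot (f := id) (z := x) hx differentiableAt_id
    ((h.metric.cov_contDiffAt hx (h.smooth_ξ x hx) (h.smooth_e₁ x hx)).differentiableAt (by simp))
    ((h.smooth_η x hx).differentiableAt (by simp)) v
  have h2 : dot (g x) (cov g e₁ ξ x) (covAlong g id η x v) = 0 := by
    rw [cov, h.cov_ξ hx, ← dotL_apply, map_smul, smul_apply, dotL_apply, h.dot_symm hx (η x),
      h.dot_cov_η hx, smul_zero]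
  simp only [id_eq, h2, add_zero] at h1
  exact h1

/-- Differentiating `∇_{e₀} ξ = 0` leaves `∇²_{v,e₀} ξ = -∇_{∇_v e₀} ξ`, which `cov_ξ` evaluates. -/
theorem dot_hess_e₀ (h : IsParallelFrame g V ξ η e₀ e₁) (hx : x ∈ V)
    (v : EuclideanSpace ℝ (Fin 2)) :
    dot (g x) (hess g ξ x v (e₀ x)) (η x)
      = -(dot (g x) (covAlong g id e₀ x v) (e₁ x) * lam g ξ η e₁ x) := by
  have h1 := h.metric.cov_cov hx (h.smooth_ξ x hx) (h.smooth_e₀ x hx) v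
  have h2 : cov g e₀ ξ =ᶠ[nhds x] fun _ => 0 := by
    filter_upwards [h.metric.eventually_mem hx] with y hy using h.parallel y hy
  have h3 : covAlong g id (cov g e₀ ξ) x v = 0 := by
    rw [covAlong_id, h2.fderiv_eq, h.parallel x hx]
    simp
  rw [h3, h.cov_ξ hx] at h1
  rw [eq_neg_of_add_eq_zero_left h1.symm, ← dotL_apply, map_neg, map_smul, neg_apply, smul_apply,
    dotL_apply, h.ηη x hx, smul_eq_mul, mul_one]

/-- Here `∇_v e₁` has no `e₁`-component, so its contribution through `cov_ξ` disappears and only the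
derivative of `λ` is left. -/
theorem dot_hess_e₁ (h : IsParallelFrame g V ξ η e₀ e₁) (hx : x ∈ V)
    (v : EuclideanSpace ℝ (Fin 2)) :
    dot (g x) (hess g ξ x v (e₁ x)) (η x) = fderiv ℝ (lam g ξ η e₁) x v := by
  have h1 := h.metric.cov_cov hx (h.smooth_ξ x hx) (h.smooth_e₁ x hx) v
  have h2 := h.metric.dot_cov_add hx (h.smooth_e₁ x hx) (h.smooth_e₁ x hx) h.e₁e₁ v
  rw [h.dot_symm hx (e₁ x)] at h2
  have h3 : dot (g x) (covAlong g id e₁ x v) (e₁ x) = 0 := by linarith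
  rw [h.cov_ξ hx (covAlong g id e₁ x v), h3, zero_mul, zero_smul, add_zero] at h1
  rw [← h1, h.fderiv_lam hx]

theorem dot_hess_e₀_e₀ (h : IsParallelFrame g V ξ η e₀ e₁) (hx : x ∈ V) :
    dot (g x) (hess g ξ x (e₀ x) (e₀ x)) (η x) = -(mu g e₀ e₁ x * lam g ξ η e₁ x) :=
  h.dot_hess_e₀ hx (e₀ x)

theorem dot_hess_e₁_e₀ (h : IsParallelFrame g V ξ η e₀ e₁) (hx : x ∈ V) :
    dot (g x) (hess g ξ x (e₁ x) (e₀ x)) (η x) = sig g e₀ e₁ x * lam g ξ η e₁ x := by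
  have h2 := h.metric.dot_cov_add hx (h.smooth_e₀ x hx) (h.smooth_e₁ x hx) h.e₀e₁ (e₁ x)
  rw [h.dot_symm hx (e₀ x)] at h2
  rw [h.dot_hess_e₀ hx, eq_neg_of_add_eq_zero_left h2, neg_mul, neg_neg]
  rfl

/-- The curvature in terms of the derivative of `λ`. -/
theorem dot_riem_frame (h : IsParallelFrame g V ξ η e₀ e₁) (hx : x ∈ V) :
    dot (g x) (riem g x (e₀ x) (e₁ x) (ξ x)) (η x)
      = fderiv ℝ (lam g ξ η e₁) x (e₀ x) - sig g e₀ e₁ x * lam g ξ η e₁ x := by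
  rw [← h.metric.hess_sub_hess hx (h.smooth_ξ x hx), ← dotL_apply, map_sub, sub_apply,
    dotL_apply, dotL_apply, h.dot_hess_e₁ hx, h.dot_hess_e₁_e₀ hx]

theorem dot_riem_frame_eq_gauss (h : IsParallelFrame g V ξ η e₀ e₁) (hx : x ∈ V) :
    dot (g x) (riem g x (e₀ x) (e₁ x) (ξ x)) (η x)
      = (-1) ^ orient g ξ η e₀ e₁ x * gaussCurvature g x := by
  have h1 := dot_mul_dot_sub (g x) (ξ x) (η x) (e₀ x) (e₁ x)
  have h2 := dot_mul_dot_sub (g x) (ξ x) (η x) (ξ x) (η x)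
  have h3 := dot_mul_dot_sub (g x) (e₀ x) (e₁ x) (e₀ x) (e₁ x)
  rw [h.ξξ x hx, h.ηη x hx, h.dot_symm hx (η x), h.ξη x hx] at h2
  rw [h.e₀e₀ x hx, h.e₁e₁ x hx, h.dot_symm hx (e₁ x), h.e₀e₁ x hx] at h3
  have hK := h.metric.gaussCurvature_mul_det hx
  -- The curvature component is `-T K`, where `T` is the transition determinant between the two
  -- frames.
  have hR : dot (g x) (riem g x (e₀ x) (e₁ x) (ξ x)) (η x)
      = -(dot (g x) (ξ x) (e₀ x) * dot (g x) (η x) (e₁ x)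
      - dot (g x) (ξ x) (e₁ x) * dot (g x) (η x) (e₀ x)) * gaussCurvature g x := by
    rw [h.metric.dot_riem_plane hx, h1]
    linear_combination ((e₀ x 0 * e₁ x 1 - e₀ x 1 * e₁ x 0) *
      (ξ x 0 * η x 1 - ξ x 1 * η x 0)) * hK
  -- For an orthonormal frame, `det g` times the squared coordinate area is `1`; the product of
  -- these identities for the two frames is `T² = 1`.
  have hT : (dot (g x) (ξ x) (e₀ x) * dot (g x) (η x) (e₁ x)
      - dot (g x) (ξ x) (e₁ x) * dot (g x) (η x) (e₀ x)) ^ 2 = 1 := by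
    rw [h1]
    linear_combination -h2 - (g x).det * (ξ x 0 * η x 1 - ξ x 1 * η x 0) ^ 2 * h3
  rw [hR, orient]
  rcases sq_eq_one_iff.1 hT with hT | hT <;> rw [hT] <;> norm_num

end IsParallelFrame

end Plane

/-! ### The lifted frame, the normal and the matrix of the second fundamental form -/

section Plane

variable {g : EuclideanSpace ℝ (Fin 2) → Matrix (Fin 2) (Fin 2) ℝ}
  {V : Set (EuclideanSpace ℝ (Fin 2))} {x : EuclideanSpace ℝ (Fin 2)}

theorem IsMetricOn.hess_smul (hg : IsMetricOn g V) (hx : x ∈ V)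
    {X : EuclideanSpace ℝ (Fin 2) → EuclideanSpace ℝ (Fin 2)} (hX : ContDiffAt ℝ ∞ X x)
    (u w : EuclideanSpace ℝ (Fin 2)) (a b : ℝ) :
    hess g X x (a • u) (b • w) = (a * b) • hess g X x u w := by
  rw [hg.hess_eq hx hX, hg.hess_eq hx hX]
  simp only [← gamL_apply, map_smul, smul_apply, covAlong_id_smul, map_add]
  module

/-- The cube matches the lower diagonal entry: one factor from the normal and one from each copy of
the rescaled `e₁`. -/
theorem fderiv_div_sqrt_one_add_sq {E : Type*} [NormedAddCommGroup E] [NormedSpace ℝ E]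
    {f : E → ℝ} {y : E} (hf : DifferentiableAt ℝ f y) (v : E) :
    fderiv ℝ (fun y => f y / √(1 + f y ^ 2)) y v
      = fderiv ℝ f y v * (1 / √(1 + f y ^ 2)) ^ 3 := by
  have h0 : (0 : ℝ) < 1 + f y ^ 2 := by positivity
  have h1 : HasDerivAt (fun t : ℝ => t / √(1 + t ^ 2)) ((1 / √(1 + f y ^ 2)) ^ 3) (f y) := by
    have h2 : HasDerivAt (fun t : ℝ => 1 + t ^ 2) (2 * f y) (f y) := by
      simpa using (hasDerivAt_pow 2 (f y)).const_add 1
    have h3 := (hasDerivAt_id (f y)).div (h2.sqrt h0.ne') (Real.sqrt_pos.2 h0).ne'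
    have h4 := Real.sq_sqrt h0.le
    have h5 := (Real.sqrt_pos.2 h0).ne'
    refine HasDerivAt.congr_deriv h3 ?_
    simp only [id_eq]
    field_simp
    rw [h4]
    ring
  have h6 : HasFDerivAt (fun y => f y / √(1 + f y ^ 2)) _ y :=
    h1.comp_hasFDerivAt y hf.hasFDerivAt
  rw [h6.fderiv]
  simp [mul_comm]

/-- The connection map sends `dX(u)` to `∇_u X`, so `dX(u) = uʰ + (∇_u X)ᵛ`. -/
theorem fderiv_toTM_eq_lift {X : EuclideanSpace ℝ (Fin 2) → EuclideanSpace ℝ (Fin 2)}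
    (hX : DifferentiableAt ℝ X x) (u : EuclideanSpace ℝ (Fin 2)) :
    fderiv ℝ (toTM X) x u = horLift g (toTM X x) u + vertLift (covAlong g id X x u) := by
  rw [← horLift_add_vertLift g (toTM X x) (fderiv ℝ (toTM X) x u), connector_fderiv_toTM hX,
    fderiv_toTM hX]
  rfl

theorem vertLift_smul {ι : Type} (c : ℝ) (u : EuclideanSpace ℝ ι) :
    vertLift (c • u) = c • vertLift u := by
  ext (i | i) <;> simp [vertLift, pair]

theorem vertLift_zero {ι : Type} : vertLift (0 : EuclideanSpace ℝ ι) = 0 := by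
  ext (i | i) <;> simp [vertLift, pair]

namespace IsParallelFrame

variable {ξ η e₀ e₁ : EuclideanSpace ℝ (Fin 2) → EuclideanSpace ℝ (Fin 2)}

theorem fderiv_toTM_preFrame (h : IsParallelFrame g V ξ η e₀ e₁) (hx : x ∈ V) (a : Fin 2) :
    fderiv ℝ (toTM ξ) x (preFrame g ξ η e₀ e₁ x a) = tangentFrame g ξ η e₀ e₁ x a := by
  have hd := (h.smooth_ξ x hx).differentiableAt (by simp)
  have h0 : dot (g x) (e₀ x) (e₁ x) = 0 := h.e₀e₁ x hx
  have h1 : dot (g x) (e₁ x) (e₁ x) = 1 := h.e₁e₁ x hx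
  fin_cases a
  · simp [preFrame, tangentFrame, fderiv_toTM_eq_lift (g := g) hd, h.cov_ξ hx, h0, vertLift_zero]
  · simp only [preFrame, tangentFrame, Fin.mk_one, Matrix.cons_val_one, Matrix.cons_val_fin_one,
      map_smul]
    rw [fderiv_toTM_eq_lift (g := g) hd, h.cov_ξ hx, h1, vertLift_smul, one_mul]

variable (ξ η e₀ e₁) in
theorem base_tangentFrame (x : EuclideanSpace ℝ (Fin 2)) (a : Fin 2) :
    base (tangentFrame g ξ η e₀ e₁ x a) = preFrame g ξ η e₀ e₁ x a := by
  rw [← baseL_apply]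
  fin_cases a <;>
    simp only [tangentFrame, preFrame, Fin.zero_eta, Fin.mk_one, Matrix.cons_val_zero,
      Matrix.cons_val_one, map_add, map_smul] <;>
    simp [baseL_apply, base_horLift, base_vertLift]

variable (ξ η e₀ e₁) in
theorem connector_tangentFrame (x : EuclideanSpace ℝ (Fin 2)) (a : Fin 2) :
    connector g (toTM ξ x) (tangentFrame g ξ η e₀ e₁ x a)
      = ![0, (1 / √(1 + lam g ξ η e₁ x ^ 2) * lam g ξ η e₁ x) • η x] a := by
  rw [← connectorL_apply]
  fin_cases a <;>
    simp only [tangentFrame, Fin.zero_eta, Fin.mk_one, Matrix.cons_val_zero,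
      Matrix.cons_val_one, map_add, map_smul] <;>
    simp [connectorL_apply, connector_horLift, connector_vertLift, smul_smul]

variable (ξ η e₁) in
theorem base_unitNormal (x : EuclideanSpace ℝ (Fin 2)) :
    base (unitNormal g ξ η e₁ x)
      = -(1 / √(1 + lam g ξ η e₁ x ^ 2) * lam g ξ η e₁ x) • e₁ x := by
  rw [← baseL_apply]
  simp only [unitNormal, map_add, map_neg, map_smul]
  simp [baseL_apply, base_horLift, base_vertLift, smul_smul]

variable (ξ η e₁) in
theorem connector_unitNormal (x : EuclideanSpace ℝ (Fin 2)) :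
    connector g (toTM ξ x) (unitNormal g ξ η e₁ x)
      = (1 / √(1 + lam g ξ η e₁ x ^ 2)) • η x := by
  rw [← connectorL_apply]
  simp only [unitNormal, map_add, map_neg, map_smul]
  simp [connectorL_apply, connector_horLift, connector_vertLift]

theorem inv_sqrt_sq_mul (l : ℝ) : (1 / √(1 + l ^ 2)) ^ 2 * (1 + l ^ 2) = 1 := by
  have h0 : (0 : ℝ) < 1 + l ^ 2 := by positivity
  rw [div_pow, Real.sq_sqrt h0.le]
  field_simp

theorem dot_tangentFrame (h : IsParallelFrame g V ξ η e₀ e₁) (hx : x ∈ V) (a b : Fin 2) :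
    dot (sasaki g (toTM ξ x)) (tangentFrame g ξ η e₀ e₁ x a) (tangentFrame g ξ η e₀ e₁ x b)
      = if a = b then 1 else 0 := by
  have hN := inv_sqrt_sq_mul (lam g ξ η e₁ x)
  rw [dot_sasaki, base_tangentFrame, base_tangentFrame, connector_tangentFrame,
    connector_tangentFrame, base_toTM]
  fin_cases a <;> fin_cases b <;>
    simp only [preFrame, ← dotL_apply, Fin.zero_eta, Fin.mk_one, Matrix.cons_val_zero,
      Matrix.cons_val_one, map_zero, map_smul, smul_apply, zero_apply, smul_eq_mul] <;>
    simp only [dotL_apply, h.e₀e₀ x hx, h.e₁e₁ x hx, h.e₀e₁ x hx, h.dot_symm hx (e₁ x) (e₀ x),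
      h.ηη x hx]
  · simp
  · simp
  · simp
  · simp only [if_true]
    linear_combination hN

theorem dot_unitNormal_self (h : IsParallelFrame g V ξ η e₀ e₁) (hx : x ∈ V) :
    dot (sasaki g (toTM ξ x)) (unitNormal g ξ η e₁ x) (unitNormal g ξ η e₁ x) = 1 := by
  have hN := inv_sqrt_sq_mul (lam g ξ η e₁ x)
  rw [dot_sasaki, base_unitNormal, connector_unitNormal, base_toTM]
  simp only [← dotL_apply, map_smul, smul_apply, smul_eq_mul]
  simp only [dotL_apply, h.e₁e₁ x hx, h.ηη x hx]
  linear_combination hN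

theorem dot_unitNormal_vertLift (h : IsParallelFrame g V ξ η e₀ e₁) (hx : x ∈ V) :
    dot (sasaki g (toTM ξ x)) (unitNormal g ξ η e₁ x) (vertLift (ξ x)) = 0 := by
  rw [dot_sasaki, base_unitNormal, connector_unitNormal, base_toTM, connector_vertLift,
    base_vertLift]
  simp only [← dotL_apply, map_smul, smul_apply, smul_eq_mul, map_zero]
  simp only [dotL_apply, h.dot_symm hx (η x), h.ξη x hx]
  ring

theorem dot_unitNormal_tangentFrame (h : IsParallelFrame g V ξ η e₀ e₁) (hx : x ∈ V)
    (a : Fin 2) :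
    dot (sasaki g (toTM ξ x)) (unitNormal g ξ η e₁ x) (tangentFrame g ξ η e₀ e₁ x a) = 0 := by
  rw [dot_sasaki, base_unitNormal, connector_unitNormal, base_tangentFrame,
    connector_tangentFrame, base_toTM]
  fin_cases a <;>
    simp only [preFrame, ← dotL_apply, Fin.zero_eta, Fin.mk_one, Matrix.cons_val_zero,
      Matrix.cons_val_one, map_zero, map_smul, smul_apply, smul_eq_mul] <;>
    simp only [dotL_apply, h.e₁e₁ x hx, h.e₀e₁ x hx, h.dot_symm hx (e₁ x) (e₀ x), h.ηη x hx] <;>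
    ring

/-- The second fundamental form of the image of `ξ` on multiples of vectors `u`, `w`. -/
theorem secondForm_smul (h : IsParallelFrame g V ξ η e₀ e₁) (hx : x ∈ V)
    (u w : EuclideanSpace ℝ (Fin 2)) (a b : ℝ) :
    secondForm g (toTM ξ) x (unitNormal g ξ η e₁ x) (a • u) (b • w)
      = a * b * (1 / √(1 + lam g ξ η e₁ x ^ 2)) * ((1 / 2) *
        (dot (g x) (hess g ξ x u w) (η x) + dot (g x) (hess g ξ x w u) (η x)
        - lam g ξ η e₁ x ^ 2 * (dot (g x) w (e₁ x) * dot (g x) (riem g x u (e₁ x) (ξ x)) (η x)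
          + dot (g x) u (e₁ x) * dot (g x) (riem g x w (e₁ x) (ξ x)) (η x)))) := by
  rw [h.metric.secondForm_eq hx (h.smooth_ξ x hx) (h.dot_unitNormal_vertLift hx),
    base_unitNormal, connector_unitNormal, h.metric.hess_smul hx (h.smooth_ξ x hx),
    h.metric.hess_smul hx (h.smooth_ξ x hx), h.cov_ξ hx, h.cov_ξ hx, h.cov_ξ hx]
  simp only [riem_smul_left, riem_smul_middle, ← dotL_apply, map_smul, map_add, add_apply,
    smul_apply, smul_eq_mul]
  simp only [dotL_apply, h.ηη x hx, h.dot_symm hx (η x)]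
  -- The terms containing `gam g x u w` cancel: together they are the scalar product of the normal
  -- with a vector tangent to the image of `ξ`.
  ring

theorem preFrame_eq_smul (x : EuclideanSpace ℝ (Fin 2)) (a : Fin 2) :
    preFrame g ξ η e₀ e₁ x a
      = ![1, 1 / √(1 + lam g ξ η e₁ x ^ 2)] a • ![e₀ x, e₁ x] a := by
  fin_cases a <;> simp [preFrame]

/-- The common source of forms (i) and (ii): the curvature component is left unevaluated so that
either expression for it can be inserted. -/
theorem secondFormMatrix_eq (h : IsParallelFrame g V ξ η e₀ e₁) (hx : x ∈ V) :
    secondFormMatrix g ξ η e₀ e₁ x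
      = !![-mu g e₀ e₁ x * (lam g ξ η e₁ x / √(1 + lam g ξ η e₁ x ^ 2)),
          fderiv ℝ (lam g ξ η e₁) x (e₀ x) / (1 + lam g ξ η e₁ x ^ 2)
            - (1 / 2) * dot (g x) (riem g x (e₀ x) (e₁ x) (ξ x)) (η x);
        fderiv ℝ (lam g ξ η e₁) x (e₀ x) / (1 + lam g ξ η e₁ x ^ 2)
            - (1 / 2) * dot (g x) (riem g x (e₀ x) (e₁ x) (ξ x)) (η x),
          fderiv ℝ (fun y => lam g ξ η e₁ y / √(1 + lam g ξ η e₁ y ^ 2)) x (e₁ x)] := by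
  have hN := inv_sqrt_sq_mul (lam g ξ η e₁ x)
  have hN' : ∀ t : ℝ, t / (1 + lam g ξ η e₁ x ^ 2)
      = t * (1 / √(1 + lam g ξ η e₁ x ^ 2)) ^ 2 := fun t => by
    rw [div_eq_mul_inv, inv_eq_of_mul_eq_one_left hN]
  have hρ := h.dot_riem_frame hx
  ext a b
  rw [secondFormMatrix, Matrix.of_apply, preFrame_eq_smul, preFrame_eq_smul, h.secondForm_smul hx]
  fin_cases a <;> fin_cases b <;>
    simp only [Fin.zero_eta, Fin.mk_one, Matrix.cons_val_zero, Matrix.cons_val_one,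
      Matrix.of_apply, h.dot_hess_e₁ hx, h.dot_hess_e₀_e₀ hx, h.dot_hess_e₁_e₀ hx, h.e₀e₁ x hx,
      h.e₁e₁ x hx, riem_self, Matrix.cons_val', Matrix.cons_val_fin_one]
  · ring
  -- With `ρ = e₀(λ) - σλ` inserted on both sides, the discrepancy is `ρ/2` times `N²(1+λ²) - 1`.
  · rw [hN', hρ]
    linear_combination (-(1 / 2) * (fderiv ℝ (lam g ξ η e₁) x (e₀ x)
      - sig g e₀ e₁ x * lam g ξ η e₁ x)) * hN
  · rw [hN', hρ]
    linear_combination (-(1 / 2) * (fderiv ℝ (lam g ξ η e₁) x (e₀ x)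
      - sig g e₀ e₁ x * lam g ξ η e₁ x)) * hN
  · rw [fderiv_div_sqrt_one_add_sq ((h.lam_contDiffAt hx).differentiableAt (by simp))]
    simp only [← dotL_apply, map_zero, zero_apply]
    ring

end IsParallelFrame

end Plane

/-! ### Reading the metric and vector fields of the manifold in a chart -/

section Chart

variable {M : Type*} [TopologicalSpace M] [ChartedSpace (EuclideanSpace ℝ (Fin 2)) M]
  {φ : OpenPartialHomeomorph M (EuclideanSpace ℝ (Fin 2))}

theorem mdifferentiable_of_mem_maximalAtlas (hφ : φ ∈ IsManifold.maximalAtlas (𝓡 2) ∞ M) :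
    φ.MDifferentiable (𝓡 2) (𝓡 2) :=
  ⟨(contMDiffOn_of_mem_maximalAtlas hφ).mdifferentiableOn (by simp),
    (contMDiffOn_symm_of_mem_maximalAtlas hφ).mdifferentiableOn (by simp)⟩

variable [IsManifold (𝓡 2) ∞ M]

theorem dot_metricIn
    (g : Bundle.ContMDiffRiemannianMetric (𝓡 2) ∞ (EuclideanSpace ℝ (Fin 2))
      (fun q : M => TangentSpace (𝓡 2) q)) (y v w : EuclideanSpace ℝ (Fin 2)) :
    dot (metricIn g φ y) v w = g.inner (φ.symm y) (mfderiv (𝓡 2) (𝓡 2) φ.symm y v)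
      (mfderiv (𝓡 2) (𝓡 2) φ.symm y w) := by
  let D : EuclideanSpace ℝ (Fin 2) →L[ℝ] EuclideanSpace ℝ (Fin 2) :=
    mfderiv (𝓡 2) (𝓡 2) φ.symm y
  let B : EuclideanSpace ℝ (Fin 2) →L[ℝ] EuclideanSpace ℝ (Fin 2) →L[ℝ] ℝ :=
    g.inner (φ.symm y)
  exact dot_of_bilin (B.bilinearComp D D) v w

/-- The differential of the inverse chart undoes that of the chart, so coordinate scalar products
are the intrinsic ones. -/
theorem dot_metricIn_fieldIn (hφ : φ ∈ IsManifold.maximalAtlas (𝓡 2) ∞ M)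
    (g : Bundle.ContMDiffRiemannianMetric (𝓡 2) ∞ (EuclideanSpace ℝ (Fin 2))
      (fun q : M => TangentSpace (𝓡 2) q)) (X Y : (q : M) → TangentSpace (𝓡 2) q)
    {y : EuclideanSpace ℝ (Fin 2)} (hy : y ∈ φ.target) :
    dot (metricIn g φ y) (fieldIn φ X y) (fieldIn φ Y y)
      = g.inner (φ.symm y) (X (φ.symm y)) (Y (φ.symm y)) := by
  have h := (mdifferentiable_of_mem_maximalAtlas hφ).symm_comp_deriv (φ.map_target hy)
  rw [φ.right_inv hy] at h
  have h1 : ∀ X : (q : M) → TangentSpace (𝓡 2) q,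
      mfderiv (𝓡 2) (𝓡 2) φ.symm y (fieldIn φ X y) = X (φ.symm y) := fun X =>
    congrArg (fun L => L (X (φ.symm y))) h
  rw [dot_metricIn, h1, h1]

theorem fieldIn_contDiffAt (hφ : φ ∈ IsManifold.maximalAtlas (𝓡 2) ∞ M) {U : Set M}
    (hU : IsOpen U) {X : (q : M) → TangentSpace (𝓡 2) q}
    (hX : ContMDiffOn (𝓡 2) (𝓡 2).tangent ∞
      (fun q => (⟨q, X q⟩ : TangentBundle (𝓡 2) M)) U)
    {y : EuclideanSpace ℝ (Fin 2)} (hy : y ∈ φ.target) (hyU : φ.symm y ∈ U) :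
    ContDiffAt ℝ ∞ (fieldIn φ X) y := by
  have hT := (contMDiffOn_of_mem_maximalAtlas hφ).contMDiffOn_tangentMapWithin (m := ∞) (by simp)
    φ.open_source.uniqueMDiffOn
  have h1 : ContMDiffAt (𝓡 2) (𝓡 2) ∞ φ.symm y :=
    (contMDiffOn_symm_of_mem_maximalAtlas hφ).contMDiffAt (φ.open_target.mem_nhds hy)
  have h2 : ContMDiffAt (𝓡 2) (𝓡 2).tangent ∞
      (fun y => (⟨φ.symm y, X (φ.symm y)⟩ : TangentBundle (𝓡 2) M)) y :=
    (hX.contMDiffAt (hU.mem_nhds hyU)).comp y h1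
  have h3 : ContMDiffAt (𝓡 2).tangent (𝓡 2).tangent ∞ (tangentMapWithin (𝓡 2) (𝓡 2) φ φ.source)
      (⟨φ.symm y, X (φ.symm y)⟩ : TangentBundle (𝓡 2) M) :=
    hT.contMDiffAt ((φ.open_source.preimage
      (FiberBundle.continuous_proj (EuclideanSpace ℝ (Fin 2)) _)).mem_nhds (φ.map_target hy))
  -- The tangent map of the chart carries the section to the tangent bundle of the model space,
  -- where the fibre component is a smooth function.
  have h4 := (contMDiff_snd_tangentBundle_modelSpace (EuclideanSpace ℝ (Fin 2)) (𝓡 2)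
    (n := ∞)).contMDiffAt.comp y (h3.comp y h2)
  refine h4.contDiffAt.congr_of_eventuallyEq ?_
  filter_upwards [φ.open_target.mem_nhds hy] with z hz
  rw [fieldIn, ← mfderivWithin_of_isOpen φ.open_source (φ.map_target hz)]
  rfl

theorem coordVec_contMDiffAt (hφ : φ ∈ IsManifold.maximalAtlas (𝓡 2) ∞ M) (i : Fin 2)
    {y : EuclideanSpace ℝ (Fin 2)} (hy : y ∈ φ.target) :
    ContMDiffAt (𝓡 2) (𝓡 2).tangent ∞
      (fun y => (⟨φ.symm y, coordVec φ i y⟩ : TangentBundle (𝓡 2) M)) y := by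
  have hT := (contMDiffOn_symm_of_mem_maximalAtlas hφ).contMDiffOn_tangentMapWithin (m := ∞)
    (by simp) φ.open_target.uniqueMDiffOn
  have h2 : ContMDiffAt (𝓡 2) (𝓡 2).tangent ∞
      (fun y => (⟨y, basisVec i⟩ : TangentBundle (𝓡 2) (EuclideanSpace ℝ (Fin 2)))) y :=
    contMDiffAt_vectorSpace_iff_contDiffAt.2 contDiffAt_const
  have h3 : ContMDiffAt (𝓡 2).tangent (𝓡 2).tangent ∞
      (tangentMapWithin (𝓡 2) (𝓡 2) φ.symm φ.target)
      (⟨y, basisVec i⟩ : TangentBundle (𝓡 2) (EuclideanSpace ℝ (Fin 2))) :=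
    hT.contMDiffAt ((φ.open_target.preimage
      (FiberBundle.continuous_proj (EuclideanSpace ℝ (Fin 2)) _)).mem_nhds hy)
  refine (h3.comp y h2).congr_of_eventuallyEq ?_
  filter_upwards [φ.open_target.mem_nhds hy] with z hz
  simp only [coordVec, Function.comp_apply, tangentMapWithin,
    mfderivWithin_of_isOpen φ.open_target hz]

theorem metricIn_contDiffAt (hφ : φ ∈ IsManifold.maximalAtlas (𝓡 2) ∞ M)
    (g : Bundle.ContMDiffRiemannianMetric (𝓡 2) ∞ (EuclideanSpace ℝ (Fin 2))
      (fun q : M => TangentSpace (𝓡 2) q)) (i j : Fin 2)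
    {y : EuclideanSpace ℝ (Fin 2)} (hy : y ∈ φ.target) :
    ContDiffAt ℝ ∞ (fun y => metricIn g φ y i j) y := by
  have hb : ContMDiffAt (𝓡 2) (𝓡 2) ∞ φ.symm y :=
    (contMDiffOn_symm_of_mem_maximalAtlas hφ).contMDiffAt (φ.open_target.mem_nhds hy)
  have h : ContMDiffAt (𝓡 2) ((𝓡 2).prod 𝓘(ℝ)) ∞
      (fun y => Bundle.TotalSpace.mk' ℝ (E := Bundle.Trivial M ℝ) (φ.symm y)
        (g.inner (φ.symm y) (coordVec φ i y) (coordVec φ j y))) y := by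
    apply ContMDiffAt.clm_bundle_apply₂ (F₁ := EuclideanSpace ℝ (Fin 2))
      (F₂ := EuclideanSpace ℝ (Fin 2))
    · exact g.contMDiff.contMDiffAt.comp y hb
    · exact coordVec_contMDiffAt hφ i hy
    · exact coordVec_contMDiffAt hφ j hy
  rw [Bundle.contMDiffAt_totalSpace] at h
  exact h.2.contDiffAt

end Chart

section Chart

variable {M : Type*} [TopologicalSpace M] [ChartedSpace (EuclideanSpace ℝ (Fin 2)) M]
  {φ : OpenPartialHomeomorph M (EuclideanSpace ℝ (Fin 2))}

/-- The determinant times the squared area of the pair is `1`; hence the frame itself guarantees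
nondegeneracy of the chart metric. -/
theorem det_ne_zero_of_orthonormal {a : Matrix (Fin 2) (Fin 2) ℝ}
    {p q : EuclideanSpace ℝ (Fin 2)} (hp : dot a p p = 1) (hq : dot a q q = 1)
    (hpq : dot a p q = 0) : a.det ≠ 0 := by
  intro h
  have := dot_mul_dot_sub a p q p q
  rw [h, hp, hq, hpq] at this
  norm_num at this

theorem isParallelFrame_fieldIn [IsManifold (𝓡 2) ∞ M]
    {g : Bundle.ContMDiffRiemannianMetric (𝓡 2) ∞ (EuclideanSpace ℝ (Fin 2))
      (fun q : M => TangentSpace (𝓡 2) q)}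
    {U : Set M} (hU : IsOpen U) {ξ η e₀ e₁ : (q : M) → TangentSpace (𝓡 2) q}
    (hξ : ContMDiffOn (𝓡 2) (𝓡 2).tangent ∞
      (fun q => (⟨q, ξ q⟩ : TangentBundle (𝓡 2) M)) U)
    (hη : ContMDiffOn (𝓡 2) (𝓡 2).tangent ∞
      (fun q => (⟨q, η q⟩ : TangentBundle (𝓡 2) M)) U)
    (he₀ : ContMDiffOn (𝓡 2) (𝓡 2).tangent ∞
      (fun q => (⟨q, e₀ q⟩ : TangentBundle (𝓡 2) M)) U)
    (he₁ : ContMDiffOn (𝓡 2) (𝓡 2).tangent ∞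
      (fun q => (⟨q, e₁ q⟩ : TangentBundle (𝓡 2) M)) U)
    (hξη : ∀ q ∈ U, g.inner q (ξ q) (ξ q) = 1 ∧ g.inner q (η q) (η q) = 1 ∧
      g.inner q (ξ q) (η q) = 0)
    (he : ∀ q ∈ U, g.inner q (e₀ q) (e₀ q) = 1 ∧ g.inner q (e₁ q) (e₁ q) = 1 ∧
      g.inner q (e₀ q) (e₁ q) = 0)
    (hφ : φ ∈ IsManifold.maximalAtlas (𝓡 2) ∞ M)
    (hpar : ∀ q ∈ U ∩ φ.source,
      cov (metricIn g φ) (fieldIn φ e₀) (fieldIn φ ξ) (φ q) = 0) :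
    IsParallelFrame (metricIn g φ) (φ.target ∩ φ.symm ⁻¹' U) (fieldIn φ ξ) (fieldIn φ η)
      (fieldIn φ e₀) (fieldIn φ e₁) where
  metric :=
    { isOpen := φ.isOpen_inter_preimage_symm hU
      smooth := fun y hy i j => metricIn_contDiffAt hφ g i j hy.1
      symm := fun y _ i j => g.symm _ _ _
      det_ne := fun y hy => det_ne_zero_of_orthonormal
        ((dot_metricIn_fieldIn hφ g ξ ξ hy.1).trans (hξη _ hy.2).1)
        ((dot_metricIn_fieldIn hφ g η η hy.1).trans (hξη _ hy.2).2.1)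
        ((dot_metricIn_fieldIn hφ g ξ η hy.1).trans (hξη _ hy.2).2.2) }
  smooth_ξ y hy := fieldIn_contDiffAt hφ hU hξ hy.1 hy.2
  smooth_η y hy := fieldIn_contDiffAt hφ hU hη hy.1 hy.2
  smooth_e₀ y hy := fieldIn_contDiffAt hφ hU he₀ hy.1 hy.2
  smooth_e₁ y hy := fieldIn_contDiffAt hφ hU he₁ hy.1 hy.2
  ξξ y hy := (dot_metricIn_fieldIn hφ g ξ ξ hy.1).trans (hξη _ hy.2).1
  ηη y hy := (dot_metricIn_fieldIn hφ g η η hy.1).trans (hξη _ hy.2).2.1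
  ξη y hy := (dot_metricIn_fieldIn hφ g ξ η hy.1).trans (hξη _ hy.2).2.2
  e₀e₀ y hy := (dot_metricIn_fieldIn hφ g e₀ e₀ hy.1).trans (he _ hy.2).1
  e₁e₁ y hy := (dot_metricIn_fieldIn hφ g e₁ e₁ hy.1).trans (he _ hy.2).2.1
  e₀e₁ y hy := (dot_metricIn_fieldIn hφ g e₀ e₁ hy.1).trans (he _ hy.2).2.2
  parallel y hy := by
    have := hpar (φ.symm y) ⟨hy.2, φ.map_target hy.1⟩
    rwa [φ.right_inv hy.1] at this

end Chart

end UnitField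

end

open UnitField in
theorem mainTheorem6 {M : Type*} [TopologicalSpace M]
    [ChartedSpace (EuclideanSpace ℝ (Fin 2)) M] [IsManifold (𝓡 2) ∞ M]
    (g : Bundle.ContMDiffRiemannianMetric (𝓡 2) ∞ (EuclideanSpace ℝ (Fin 2))
      (fun q : M => TangentSpace (𝓡 2) q))
    (U : Set M) (hU : IsOpen U)
    (ξ η e₀ e₁ : (q : M) → TangentSpace (𝓡 2) q)
    -- the four vector fields are smooth on `U`
    (hξ : ContMDiffOn (𝓡 2) (𝓡 2).tangent ∞
      (fun q => (⟨q, ξ q⟩ : TangentBundle (𝓡 2) M)) U)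
    (hη : ContMDiffOn (𝓡 2) (𝓡 2).tangent ∞
      (fun q => (⟨q, η q⟩ : TangentBundle (𝓡 2) M)) U)
    (he₀ : ContMDiffOn (𝓡 2) (𝓡 2).tangent ∞
      (fun q => (⟨q, e₀ q⟩ : TangentBundle (𝓡 2) M)) U)
    (he₁ : ContMDiffOn (𝓡 2) (𝓡 2).tangent ∞
      (fun q => (⟨q, e₁ q⟩ : TangentBundle (𝓡 2) M)) U)
    -- `(ξ, η)` and `(e₀, e₁)` are orthonormal frames on `U`
    (hξη : ∀ q ∈ U, g.inner q (ξ q) (ξ q) = 1 ∧ g.inner q (η q) (η q) = 1 ∧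
      g.inner q (ξ q) (η q) = 0)
    (he : ∀ q ∈ U, g.inner q (e₀ q) (e₀ q) = 1 ∧ g.inner q (e₁ q) (e₁ q) = 1 ∧
      g.inner q (e₀ q) (e₁ q) = 0)
    -- an arbitrary chart of the smooth structure, in which the notions below are computed
    (φ : OpenPartialHomeomorph M (EuclideanSpace ℝ (Fin 2)))
    (hφ : φ ∈ IsManifold.maximalAtlas (𝓡 2) ∞ M)
    -- `∇_{e₀} ξ = 0`
    (hpar : ∀ q ∈ U ∩ φ.source,
      cov (metricIn g φ) (fieldIn φ e₀) (fieldIn φ ξ) (φ q) = 0)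
    (p : M) (hp : p ∈ U ∩ φ.source) :
    let G := metricIn g φ
    let X := fieldIn φ ξ
    let Y := fieldIn φ η
    let E₀ := fieldIn φ e₀
    let E₁ := fieldIn φ e₁
    let x := φ p
    let S := sasaki G (toTM X x)
    let l := lam G X Y E₁
    let s := orient G X Y E₀ E₁ x
    let K := gaussCurvature G x
    let dl₀ := fderiv ℝ l x (E₀ x)
    let dl₁ := fderiv ℝ (fun y => l y / √(1 + l y ^ 2)) x (E₁ x)
    let e := tangentFrame G X Y E₀ E₁ x
    let n := unitNormal G X Y E₁ x
    -- `(ẽ₀, ẽ₁)` is an orthonormal frame of the tangent plane of `ξ(M)`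
    (∀ a, fderiv ℝ (toTM X) x (preFrame G X Y E₀ E₁ x a) = e a) ∧
    (∀ a b, dot S (e a) (e b) = if a = b then 1 else 0) ∧
    -- `ñ` is a unit vector tangent to `T₁M` and normal to `ξ(M)`
    dot S n n = 1 ∧ dot S n (vertLift (X x)) = 0 ∧ (∀ a, dot S n (e a) = 0) ∧
    -- form (i)
    secondFormMatrix G X Y E₀ E₁ x =
      !![-mu G E₀ E₁ x * (l x / √(1 + l x ^ 2)),
          (-1) ^ (s + 1) * (K / 2) + dl₀ / (1 + l x ^ 2);
        (-1) ^ (s + 1) * (K / 2) + dl₀ / (1 + l x ^ 2),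
          dl₁] ∧
    -- form (ii)
    secondFormMatrix G X Y E₀ E₁ x =
      !![-mu G E₀ E₁ x * (l x / √(1 + l x ^ 2)),
          (1 / 2) * (sig G E₀ E₁ x * l x + (1 - l x ^ 2) / (1 + l x ^ 2) * dl₀);
        (1 / 2) * (sig G E₀ E₁ x * l x + (1 - l x ^ 2) / (1 + l x ^ 2) * dl₀),
          dl₁] := by
  intro G X Y E₀ E₁ x S l s K dl₀ dl₁ e n
  have h : IsParallelFrame G (φ.target ∩ φ.symm ⁻¹' U) X Y E₀ E₁ :=
    isParallelFrame_fieldIn hU hξ hη he₀ he₁ hξη he hφ hpar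
  have hx : x ∈ φ.target ∩ φ.symm ⁻¹' U :=
    ⟨φ.map_source hp.2, by rw [Set.mem_preimage, φ.left_inv hp.2]; exact hp.1⟩
  have hN : 1 + l x ^ 2 ≠ 0 := by positivity
  refine ⟨h.fderiv_toTM_preFrame hx, h.dot_tangentFrame hx, h.dot_unitNormal_self hx,
    h.dot_unitNormal_vertLift hx, h.dot_unitNormal_tangentFrame hx, ?_, ?_⟩
  -- Form (i): the curvature component is expressed by `K`; the minus sign in front of it shifts the
  -- exponent from `s` to `s + 1`.
  · rw [h.secondFormMatrix_eq hx, h.dot_riem_frame_eq_gauss hx]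
    have h1 : dl₀ / (1 + l x ^ 2) - (1 / 2) * ((-1) ^ s * K)
        = (-1) ^ (s + 1) * (K / 2) + dl₀ / (1 + l x ^ 2) := by ring
    exact h1 ▸ rfl
  -- Form (ii): the same component is expressed by the derivative of `λ`.
  · rw [h.secondFormMatrix_eq hx, h.dot_riem_frame hx]
    have h1 : dl₀ / (1 + l x ^ 2) - (1 / 2) * (dl₀ - sig G E₀ E₁ x * l x)
        = (1 / 2) * (sig G E₀ E₁ x * l x + (1 - l x ^ 2) / (1 + l x ^ 2) * dl₀) := by
      field_simp
      ring
    exact h1 ▸ rfl
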